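/- **Theorem 3.1.** Let $\{X_n, n\ge 1\}$ be a sequence of i.i.d. random variables with nondegenerate common distribution function, $E(X_1)=0$ and $E(X_1^2)=1$. Write $S_n=\sum_{i=1}^n X_i$, and for $1\le k\le n$ let $M_n^{(k)}$ be the $k$-th largest of $X_1,\dots,X_n$ (counted with multiplicity; the value assigned to $M_n^{(k)}$ for $n<k$ is irrelevant, say $0$). Suppose that there are constants $a_n>0$, $b_n\in\mathbb{R}$, $n\ge1$, and a non-degenerate probability distribution function $G$ on $\mathbb{R}$ such that $$\lim_{n\to\infty}P\bigl(a_n(M_n^{(1)}-b_n)\le x\bigr)=G(x)\qquad\text{for all }x\in\mathbb{R}.$$ Let $\Phi$ be the standard normal distribution function, let $I(\cdot)$ denote the indicator of an event, and fix $k\ge1$. Then: 1. For any $x,y\in\mathbb{R}$, $$\lim_{N\to\infty}\frac{1}{\log N}\sum_{n=1}^N\frac1n I\Bigl(a_n(M_n^{(k)}-b_n)\le x,\ \frac{S_n}{\sqrt n}\le y\Bigr)=G(x)\sum_{i=0}^{k-1}\frac{(-\ln G(x))^i}{i!}\,\Phi(y)\quad\text{a.s.},$$ where the right-hand side is read as $0$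 if $G(x)=0$. 2. The vector $\bigl(a_n(M_n^{(1)}-b_n),\dots,a_n(M_n^{(k)}-b_n)\bigr)$ has a joint limit distribution: there is a probability distribution function $H$ on $\mathbb{R}^k$ with $$\lim_{n\to\infty}P\bigl(a_n(M_n^{(1)}-b_n)\le x_1,\dots,a_n(M_n^{(k)}-b_n)\le x_k\bigr)=H(x_1,\dots,x_k)\qquad\text{for all }x_1,\dots,x_k\in\mathbb{R},$$ and for any $x_1,\dots,x_k,y\in\mathbb{R}$, $$\lim_{N\to\infty}\frac{1}{\log N}\sum_{n=1}^N\frac1n I\Bigl(a_n(M_n^{(1)}-b_n)\le x_1,\dots,a_n(M_n^{(k)}-b_n)\le x_k,\ \frac{S_n}{\sqrt n}\le y\Bigr)=H(x_1,\dots,x_k)\,\Phi(y)\quad\text{a.s.}$$ -/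

import Mathlib

open MeasureTheory ProbabilityTheory Filter Topology

/-- The `k`-th largest (`k = 1` is the maximum, ties counted with multiplicity) of the `n` sample
values `X 0 ω, …, X (n - 1) ω`: the `k`-th entry of the sample sorted in decreasing order.
It has the placeholder value `0` when `n < k` (or `k = 0`), where there is no such order statistic. -/
noncomputable def kthMax {Ω : Type*} (X : ℕ → Ω → ℝ) (k n : ℕ) (ω : Ω) : ℝ :=
  if 1 ≤ k then
    (((Multiset.range n).map (fun i => X i ω)).sort (fun s t => t ≤ s)).getD (k - 1) 0
  else 0

/-- The partial sum of the first `n` variables. -/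
noncomputable def partialSum {Ω : Type*} (X : ℕ → Ω → ℝ) (n : ℕ) (ω : Ω) : ℝ :=
  ∑ i ∈ Finset.range n, X i ω

/-- The logarithmic average `(1 / log N) ∑_{n = 1}^N (1 / n) I(A n)` of the indicators of the
events `A n`, at the sample point `ω`. -/
noncomputable def logAverage {Ω : Type*} (A : ℕ → Set Ω) (N : ℕ) (ω : Ω) : ℝ :=
  (1 / Real.log N) * ∑ n ∈ Finset.Icc 1 N, (1 / (n : ℝ)) * (A n).indicator (fun _ => (1 : ℝ)) ω

/-- The distribution function of the standard normal law. -/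
noncomputable def stdNormalCDF (y : ℝ) : ℝ := cdf (gaussianReal 0 1) y

/-! The `k`-th largest value is at most `v` exactly when at most `k - 1` variables exceed `v`, so
each event in question is a `fewExceed` event intersected with `S_n / √n ≤ y`. Let `ξ_n` be the
indicator of the `fewExceed` event times `f (S_n / √n)`, with `f` Lipschitz and `[0, 1]`-valued. The
almost sure limits follow from two facts about `ξ_n`.

Weak dependence: for `2 m ≤ n`, recomputing `ξ_n` from the indices in `[m, n)` alone makes it
independent of `ξ_m` at an `L¹` cost of order `√(m / n)`; for `n < 2 m` the trivial bound has that
order too (`abs_covariance_fewExceed_le`). Logarithmic sums then have variance `O(log N)`, and a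
second-moment argument along `N = 2 ^ (n ^ 2)` with monotone interpolation shows that the
logarithmic averages of `ξ_n` converge almost surely to `lim E ξ_n` (`ae_tendsto_logarithmic_mean`).

Limit of the means: the joint characteristic function of `S_n / √n` and the exceedance counts is an
`n`-th power `φ_n ^ n`. In `n (φ_n - 1)` the sum contributes `-t² / 2`, the counts contribute their
own exponent, and the cross term vanishes because one variable exceeds a level only with probability
`O(1 / n)` (`tendsto_charFun_sumCountStep_pow`). The limit law is therefore a product of a Gaussian
and a count law. For one level the count is Poisson with mean `-log G(x)`, whose distribution
function is the sum in the first claim. Levels with `G(x) = 0` are treated separately: there the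
event has vanishing probability.

Ramps sandwich the indicator of `S_n / √n ≤ y`, using continuity of the normal distribution
function. That the joint limit is a genuine distribution function follows from its marginals
(`exists_law_of_tendsto_Iic`). -/

theorem List.getD_le_iff_countP_le {l : List ℝ} (hl : l.Pairwise (fun s t => t ≤ s)) (v : ℝ) {i : ℕ}
    (hi : i < l.length) : l.getD i 0 ≤ v ↔ l.countP (fun s => decide (v < s)) ≤ i := by
  induction l generalizing i with
  | nil => simp at hi
  | cons a t ih =>
    rw [List.pairwise_cons] at hl
    have hcount : a ≤ v → t.countP (fun s => decide (v < s)) = 0 := by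
      intro hav
      rw [List.countP_eq_zero]
      intro s hs
      simpa using (hl.1 s hs).trans hav
    by_cases hav : v < a
    · rw [List.countP_cons_of_pos (by simpa using hav)]
      cases i with
      | zero => simpa using hav
      | succ i =>
        rw [List.getD_cons_succ, ih hl.2 (by simpa using hi)]
        omega
    · rw [List.countP_cons_of_neg (by simpa using hav), hcount (not_lt.1 hav)]
      cases i with
      | zero => simpa using hav
      | succ i =>
        have hit : i < t.length := by simpa using hi
        rw [List.getD_cons_succ, List.getD_eq_getElem _ _ hit]
        simpa using (hl.1 _ (List.getElem_mem hit)).trans (not_lt.1 hav)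

/-- The number of indices `i ∈ s` with `X i ω > v`. -/
noncomputable def exceedCount {Ω : Type*} (X : ℕ → Ω → ℝ) (s : Finset ℕ) (v : ℝ) (ω : Ω) : ℕ :=
  by classical exact (s.filter (fun i => v < X i ω)).card

/-! ### Order statistics through exceedance counts -/

section OrderStatistics

variable {Ω : Type*} {X : ℕ → Ω → ℝ}

theorem exceedCount_eq_sum (X : ℕ → Ω → ℝ) (s : Finset ℕ) (v : ℝ) (ω : Ω) :
    exceedCount X s v ω = ∑ i ∈ s, (Set.Ioi v).indicator (fun _ => 1) (X i ω) := by
  classical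
  rw [exceedCount, Finset.card_filter]
  refine Finset.sum_congr rfl fun i _ => ?_
  simp [Set.indicator_apply]

/-- Passes from order statistics to counts, which are additive over blocks of indices. The condition
`k ≤ n` keeps the placeholder value `0` out. -/
theorem kthMax_le_iff {k n : ℕ} (hk : 1 ≤ k) (hkn : k ≤ n) (v : ℝ) (ω : Ω) :
    kthMax X k n ω ≤ v ↔ exceedCount X (Finset.range n) v ω ≤ k - 1 := by
  classical
  rw [kthMax, if_pos hk, List.getD_le_iff_countP_le (Multiset.pairwise_sort _ _)
    _ (by simp; omega), ← Multiset.coe_countP, Multiset.sort_eq, Multiset.countP_map,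
    exceedCount, Finset.card_def, Finset.filter_val, Finset.range_val]
  
end OrderStatistics

/-! ### Deterministic facts on logarithmic means -/

section LogarithmicMeans

theorem sum_Icc_inv_eq_harmonic (N : ℕ) :
    ∑ n ∈ Finset.Icc 1 N, 1 / (n : ℝ) = (harmonic N : ℝ) := by
  rw [harmonic_eq_sum_Icc]
  push_cast
  simp

theorem tendsto_sum_inv_div_log :
    Tendsto (fun N : ℕ => (1 / Real.log N) * ∑ n ∈ Finset.Icc 1 N, 1 / (n : ℝ)) atTop (𝓝 1) := by
  have hlog : Tendsto (fun N : ℕ => Real.log (N : ℝ)) atTop atTop :=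
    Real.tendsto_log_atTop.comp tendsto_natCast_atTop_atTop
  have hupper : Tendsto (fun N : ℕ => 1 / Real.log (N : ℝ) + 1) atTop (𝓝 1) := by
    simpa using (hlog.inv_tendsto_atTop.add_const (1 : ℝ))
  refine tendsto_of_tendsto_of_tendsto_of_le_of_le' tendsto_const_nhds hupper ?_ ?_
  · filter_upwards [eventually_ge_atTop 2] with N hN
    have hpos : 0 < Real.log (N : ℝ) := Real.log_pos (by exact_mod_cast hN)
    rw [sum_Icc_inv_eq_harmonic, one_div, inv_mul_eq_div, le_div_iff₀ hpos, one_mul]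
    refine le_trans ?_ (log_add_one_le_harmonic N)
    exact Real.log_le_log (by positivity) (by push_cast; linarith)
  · filter_upwards [eventually_ge_atTop 2] with N hN
    have hpos : 0 < Real.log (N : ℝ) := Real.log_pos (by exact_mod_cast hN)
    rw [sum_Icc_inv_eq_harmonic]
    have := harmonic_le_one_add_log N
    calc 1 / Real.log N * (harmonic N : ℝ) ≤ 1 / Real.log N * (1 + Real.log N) := by gcongr
      _ = 1 / Real.log N + 1 := by field_simp

/-- Toeplitz summation: the weights `1 / n` have divergent sum asymptotic to `log N`, so terms that
are `o(1 / n)` add up to `o(log N)`. -/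
theorem tendsto_logarithmic_mean {e : ℕ → ℝ} {l : ℝ} (he : Tendsto e atTop (𝓝 l)) :
    Tendsto (fun N : ℕ => (1 / Real.log N) * ∑ n ∈ Finset.Icc 1 N, 1 / (n : ℝ) * e n)
      atTop (𝓝 l) := by
  have hsum : ∀ (g : ℕ → ℝ) (N : ℕ), ∑ n ∈ Finset.Icc 1 N, g n
      = ∑ n ∈ Finset.range N, g (n + 1) := by
    intro g N
    induction N with
    | zero => simp
    | succ N ih => rw [Finset.sum_Icc_succ_top (by omega), Finset.sum_range_succ, ih]
  have hdiv : Tendsto (fun N : ℕ => ∑ n ∈ Finset.range N, 1 / ((n + 1 : ℕ) : ℝ)) atTop atTop := by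
    simpa using Real.tendsto_sum_range_one_div_nat_succ_atTop
  have ho : (fun n : ℕ => 1 / ((n + 1 : ℕ) : ℝ) * (e (n + 1) - l))
      =o[atTop] fun n : ℕ => 1 / ((n + 1 : ℕ) : ℝ) := by
    have h0 : Tendsto (fun n => e (n + 1) - l) atTop (𝓝 0) := by
      simpa using ((tendsto_add_atTop_iff_nat 1).2 he).sub_const l
    simpa using (Asymptotics.isBigO_refl (fun n : ℕ => 1 / ((n + 1 : ℕ) : ℝ)) atTop).mul_isLittleO
      ((Asymptotics.isLittleO_one_iff ℝ).2 h0)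
  have hs := ho.sum_range (fun n => by positivity) hdiv
  have hratio := hs.tendsto_div_nhds_zero
  have key := (hratio.mul tendsto_sum_inv_div_log).add (tendsto_sum_inv_div_log.const_mul l)
  simp only [mul_one, zero_add] at key
  refine key.congr' ?_
  filter_upwards [eventually_ge_atTop 1] with N hN
  have hpos : 0 < ∑ n ∈ Finset.range N, 1 / ((n + 1 : ℕ) : ℝ) :=
    Finset.sum_pos (fun n _ => by positivity) (by simp; omega)
  rw [hsum, hsum]
  simp only [mul_sub, Finset.sum_sub_distrib, ← Finset.sum_mul]
  field_simp
  ring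

/-- Discards the finitely many `n < k`, where the order statistic is only a placeholder. -/
theorem logAverage_tendsto_congr {Ω : Type*} {A B : ℕ → Set Ω} {ω : Ω} {l : ℝ}
    (hAB : ∀ᶠ n in atTop, A n = B n)
    (hB : Tendsto (fun N => logAverage B N ω) atTop (𝓝 l)) :
    Tendsto (fun N => logAverage A N ω) atTop (𝓝 l) := by
  have h0 : Tendsto (fun n => (A n).indicator (fun _ => (1 : ℝ)) ω -
      (B n).indicator (fun _ => (1 : ℝ)) ω) atTop (𝓝 0) :=
    tendsto_const_nhds.congr' (hAB.mono fun n hn => by simp [hn])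
  have := (tendsto_logarithmic_mean h0).add hB
  rw [zero_add] at this
  refine this.congr fun N => ?_
  simp only [logAverage, mul_sub, Finset.sum_sub_distrib]
  ring

theorem sum_Icc_inv_sqrt_le (n : ℕ) : ∑ m ∈ Finset.Icc 1 n, 1 / √(m : ℝ) ≤ 2 * √(n : ℝ) := by
  induction n with
  | zero => simp
  | succ n ih =>
    rw [Finset.sum_Icc_succ_top (by omega)]
    have h1 : 0 < √((n + 1 : ℕ) : ℝ) := by positivity
    have h2 : √((n + 1 : ℕ) : ℝ) ^ 2 = n + 1 := by
      rw [Real.sq_sqrt (by positivity)]; push_cast; ring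
    have h3 : √(n : ℝ) ^ 2 = n := Real.sq_sqrt (by positivity)
    have h4 : 1 / √((n + 1 : ℕ) : ℝ) ≤ 2 * √((n + 1 : ℕ) : ℝ) - 2 * √(n : ℝ) := by
      rw [div_le_iff₀ h1]
      nlinarith [sq_nonneg (√((n + 1 : ℕ) : ℝ) - √(n : ℝ))]
    linarith

end LogarithmicMeans

/-! ### Strong law for logarithmic averages -/

section StrongLaw

/-- By Tonelli the series of squares has finite expectation, so it converges almost surely and its
terms vanish. -/
theorem ae_tendsto_zero_of_summable_integral_sq {Ω : Type*} [MeasurableSpace Ω]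
    {μ : Measure Ω} {Y : ℕ → Ω → ℝ} (hL2 : ∀ n, MemLp (Y n) 2 μ)
    (hs : Summable fun n => ∫ ω, Y n ω ^ 2 ∂μ) :
    ∀ᵐ ω ∂μ, Tendsto (fun n => Y n ω) atTop (𝓝 0) := by
  have hmeas : ∀ n, AEMeasurable (fun ω => ENNReal.ofReal (Y n ω ^ 2)) μ := fun n =>
    ((hL2 n).aestronglyMeasurable.aemeasurable.pow_const 2).ennreal_ofReal
  have hfin : ∫⁻ ω, ∑' n, ENNReal.ofReal (Y n ω ^ 2) ∂μ ≠ ⊤ := by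
    rw [lintegral_tsum hmeas]
    have : ∀ n, ∫⁻ ω, ENNReal.ofReal (Y n ω ^ 2) ∂μ = ENNReal.ofReal (∫ ω, Y n ω ^ 2 ∂μ) :=
      fun n => (ofReal_integral_eq_lintegral_ofReal (hL2 n).integrable_sq
        (Eventually.of_forall fun ω => sq_nonneg _)).symm
    simp_rw [this]
    rw [← ENNReal.ofReal_tsum_of_nonneg (fun n => integral_nonneg fun ω => sq_nonneg _) hs]
    exact ENNReal.ofReal_ne_top
  filter_upwards [ae_lt_top' (AEMeasurable.tsum hmeas) hfin] with ω hω
  have h1 := ENNReal.tendsto_atTop_zero_of_tsum_ne_top hω.ne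
  have h2 : Tendsto (fun n => Y n ω ^ 2) atTop (𝓝 0) := by
    have := (ENNReal.tendsto_toReal ENNReal.zero_ne_top).comp h1
    simpa [Function.comp_def, ENNReal.toReal_ofReal (sq_nonneg _)] using this
  have h3 := h2.sqrt
  simp only [Real.sqrt_sq_eq_abs, Real.sqrt_zero] at h3
  exact (tendsto_zero_iff_abs_tendsto_zero _).2 h3

variable {Ω : Type*} [MeasurableSpace Ω] {μ : Measure Ω} [IsProbabilityMeasure μ]

/-- For fixed `n`, the terms `m ≤ n` contribute at most `C / (n √n)` times the sum of `1 / √m`,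
hence at most `2 C / n`. The double sum collapses to a harmonic sum, one power of `log N` below the
squared normalisation. -/
theorem variance_logarithmic_sum_le {ξ : ℕ → Ω → ℝ} (hL2 : ∀ n, MemLp (ξ n) 2 μ) {C : ℝ}
    (hcov : ∀ m n, 1 ≤ m → m ≤ n → |cov[ξ m, ξ n; μ]| ≤ C * (√(m : ℝ) / √(n : ℝ))) (N : ℕ) :
    Var[fun ω => ∑ n ∈ Finset.Icc 1 N, 1 / (n : ℝ) * ξ n ω; μ] ≤ 4 * C * (1 + Real.log N) := by
  have hC : 0 ≤ C := by
    have := (abs_nonneg _).trans (hcov 1 1 le_rfl le_rfl)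
    simpa using this
  set g : ℕ → ℕ → ℝ := fun m n =>
    if m ≤ n then 1 / (m : ℝ) * (1 / (n : ℝ)) * (C * (√(m : ℝ) / √(n : ℝ))) else 0 with hg
  have hgnn : ∀ m n, 0 ≤ g m n := by
    intro m n
    simp only [hg]
    split_ifs <;> positivity
  have hinner : ∑ n ∈ Finset.Icc 1 N, ∑ m ∈ Finset.Icc 1 N, g m n
      ≤ 2 * C * ∑ n ∈ Finset.Icc 1 N, 1 / (n : ℝ) := by
    rw [Finset.mul_sum]
    refine Finset.sum_le_sum fun n hn => ?_
    rw [Finset.mem_Icc] at hn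
    have hn0 : (0 : ℝ) < n := by exact_mod_cast hn.1
    have hsub : ∑ m ∈ Finset.Icc 1 N, g m n
        = ∑ m ∈ Finset.Icc 1 n, (C / (n * √(n : ℝ))) * (1 / √(m : ℝ)) := by
      rw [← Finset.sum_subset (Finset.Icc_subset_Icc_right hn.2)]
      · refine Finset.sum_congr rfl fun m hm => ?_
        rw [Finset.mem_Icc] at hm
        have hm0 : (0 : ℝ) < m := by exact_mod_cast hm.1
        have hs : √(m : ℝ) * √(m : ℝ) = m := Real.mul_self_sqrt hm0.le
        have hsp : 0 < √(m : ℝ) := Real.sqrt_pos.2 hm0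
        simp only [hg, if_pos hm.2]
        field_simp
        nlinarith [hs]
      · intro m hm hmn
        simp only [Finset.mem_Icc] at hm hmn
        simp only [hg]
        rw [if_neg (by omega)]
    rw [hsub, ← Finset.mul_sum]
    calc C / (n * √(n : ℝ)) * ∑ m ∈ Finset.Icc 1 n, 1 / √(m : ℝ)
        ≤ C / (n * √(n : ℝ)) * (2 * √(n : ℝ)) := by gcongr; exact sum_Icc_inv_sqrt_le n
      _ = 2 * C * (1 / (n : ℝ)) := by
        have : 0 < √(n : ℝ) := Real.sqrt_pos.2 hn0
        field_simp
  have hL2' : ∀ n : ℕ, MemLp (fun ω => 1 / (n : ℝ) * ξ n ω) 2 μ := fun n => (hL2 n).const_mul _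
  rw [variance_fun_sum' fun n _ => hL2' n]
  simp_rw [covariance_const_mul_left, covariance_const_mul_right]
  calc ∑ i ∈ Finset.Icc 1 N, ∑ j ∈ Finset.Icc 1 N,
        1 / (i : ℝ) * (1 / (j : ℝ) * cov[ξ i, ξ j; μ])
      -- Each pair is dominated by whichever of the two terms has its indices in increasing order;
      -- the diagonal is counted twice, which is harmless for an upper bound.
      ≤ ∑ i ∈ Finset.Icc 1 N, ∑ j ∈ Finset.Icc 1 N, (g i j + g j i) := by
        refine Finset.sum_le_sum fun i hi => Finset.sum_le_sum fun j hj => ?_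
        rw [Finset.mem_Icc] at hi hj
        have aux : ∀ m n : ℕ, 1 ≤ m → m ≤ n → 1 / (m : ℝ) * (1 / (n : ℝ) * cov[ξ m, ξ n; μ]) ≤ g m n := by
          intro m n hm hmn
          simp only [hg, if_pos hmn]
          rw [← mul_assoc]
          gcongr
          exact (le_abs_self _).trans (hcov m n hm hmn)
        rcases le_total i j with h | h
        · linarith [aux i j hi.1 h, hgnn j i]
        · have := aux j i hj.1 h
          rw [covariance_comm] at this
          have h2 := hgnn i j
          linarith [show 1 / (i : ℝ) * (1 / (j : ℝ) * cov[ξ i, ξ j; μ])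
            = 1 / (j : ℝ) * (1 / (i : ℝ) * cov[ξ i, ξ j; μ]) by ring]
    _ = 2 * ∑ n ∈ Finset.Icc 1 N, ∑ m ∈ Finset.Icc 1 N, g m n := by
        simp only [Finset.sum_add_distrib]
        rw [Finset.sum_comm]
        ring
    _ ≤ 2 * (2 * C * ∑ n ∈ Finset.Icc 1 N, 1 / (n : ℝ)) := by gcongr
    _ ≤ 4 * C * (1 + Real.log N) := by
        rw [sum_Icc_inv_eq_harmonic]
        have := harmonic_le_one_add_log N
        nlinarith

/-- Two monotone interpolations: from the exponents `n ^ 2` to all exponents, since `(n + 1)² / n² →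
1`, and from powers of two to all `N`, by bracketing `N` between `2 ^ n` and `2 ^ (n + 1)` with `n =
Nat.log 2 N`. -/
theorem tendsto_div_log_of_dyadic {T : ℕ → ℝ} (hmono : Monotone T) (hT0 : ∀ n, 0 ≤ T n) {l : ℝ}
    (h : Tendsto (fun n : ℕ => T (2 ^ (n ^ 2)) / ((n ^ 2 : ℕ) : ℝ)) atTop (𝓝 (l * Real.log 2))) :
    Tendsto (fun N : ℕ => 1 / Real.log N * T N) atTop (𝓝 l) := by
  have hlog2 : 0 < Real.log 2 := Real.log_pos one_lt_two
  have hdy : Tendsto (fun n : ℕ => T (2 ^ n) / n) atTop (𝓝 (l * Real.log 2)) := by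
    refine tendsto_div_of_monotone_of_exists_subseq_tendsto_div _ _
      (fun a b hab => hmono (Nat.pow_le_pow_right (by norm_num) hab)) fun a ha => ?_
    refine ⟨fun n => n ^ 2, ?_, tendsto_pow_atTop (by norm_num), h⟩
    have hr : Tendsto (fun n : ℕ => (1 + 1 / (n : ℝ)) ^ 2) atTop (𝓝 1) := by
      simpa using (tendsto_one_div_atTop_nhds_zero_nat.const_add (1 : ℝ)).pow 2
    filter_upwards [hr.eventually_lt_const ha, eventually_ge_atTop 1] with n hn hn1
    have hn0 : (0 : ℝ) < n := by exact_mod_cast hn1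
    have : ((n + 1) ^ 2 : ℝ) = (1 + 1 / (n : ℝ)) ^ 2 * n ^ 2 := by field_simp
    push_cast
    rw [this]
    gcongr
  have hlogN : Tendsto (fun N : ℕ => Nat.log 2 N) atTop atTop := by
    refine tendsto_atTop.2 fun b => ?_
    filter_upwards [eventually_ge_atTop (2 ^ b)] with N hN
    exact Nat.le_log_of_pow_le (by norm_num) hN
  have hratio : Tendsto (fun n : ℕ => ((n : ℝ) + 1) / n) atTop (𝓝 1) := by
    have : Tendsto (fun n : ℕ => 1 + 1 / (n : ℝ)) atTop (𝓝 (1 + 0)) :=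
      tendsto_one_div_atTop_nhds_zero_nat.const_add 1
    rw [add_zero] at this
    refine this.congr' ?_
    filter_upwards [eventually_ge_atTop 1] with n hn
    have hn0 : (n : ℝ) ≠ 0 := by positivity
    field_simp
  have hlow : Tendsto (fun n : ℕ => T (2 ^ n) / n * (((n : ℝ) + 1) / n)⁻¹ / Real.log 2)
      atTop (𝓝 l) := by
    have := (hdy.mul (hratio.inv₀ one_ne_zero)).div_const (Real.log 2)
    simpa [hlog2.ne'] using this
  have hup : Tendsto (fun n : ℕ => T (2 ^ (n + 1)) / ((n + 1 : ℕ) : ℝ) * (((n : ℝ) + 1) / n)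
      / Real.log 2) atTop (𝓝 l) := by
    have := ((((tendsto_add_atTop_iff_nat 1).2 hdy)).mul hratio).div_const (Real.log 2)
    simpa [hlog2.ne'] using this
  refine tendsto_of_tendsto_of_tendsto_of_le_of_le' (hlow.comp hlogN) (hup.comp hlogN) ?_ ?_
  all_goals
    filter_upwards [eventually_ge_atTop 2] with N hN
    set n := Nat.log 2 N with hn
    have hn1 : 1 ≤ n := Nat.le_log_of_pow_le (by norm_num) (by simpa using hN)
    have hnpos : (0 : ℝ) < n := by exact_mod_cast hn1
    have hlogpos : 0 < Real.log (N : ℝ) := Real.log_pos (by exact_mod_cast hN)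
    have hle : 2 ^ n ≤ N := Nat.pow_log_le_self 2 (by omega)
    have hlt : N < 2 ^ (n + 1) := Nat.lt_pow_succ_log_self (by norm_num) N
    have hl1 : n * Real.log 2 ≤ Real.log N := by
      rw [← Real.log_pow]
      exact Real.log_le_log (by positivity) (by exact_mod_cast hle)
    have hl2 : Real.log N ≤ (n + 1) * Real.log 2 := by
      have : Real.log N ≤ Real.log (2 ^ (n + 1)) :=
        Real.log_le_log (by positivity) (by exact_mod_cast hlt.le)
      rw [Real.log_pow] at this
      exact_mod_cast this
    have hTN1 := hmono hle
    have hTN2 := hmono hlt.le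
    simp only [Function.comp_apply, ← hn]
  · have e1 : T (2 ^ n) / n * (((n : ℝ) + 1) / n)⁻¹ / Real.log 2
        = T (2 ^ n) / ((n + 1) * Real.log 2) := by field_simp
    rw [e1, one_div, inv_mul_eq_div]
    exact div_le_div₀ (hT0 _) hTN1 hlogpos hl2
  · have e1 : T (2 ^ (n + 1)) / ((n + 1 : ℕ) : ℝ) * (((n : ℝ) + 1) / n) / Real.log 2
        = T (2 ^ (n + 1)) / (n * Real.log 2) := by push_cast; field_simp
    rw [e1, one_div, inv_mul_eq_div]
    exact div_le_div₀ (hT0 _) hTN2 (by positivity) hl1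

/-- A strong law for logarithmic averages of `[0, 1]`-valued variables with polynomially decaying
correlations. -/
theorem ae_tendsto_logarithmic_mean {ξ : ℕ → Ω → ℝ} (hmeas : ∀ n, Measurable (ξ n))
    (h0 : ∀ n ω, 0 ≤ ξ n ω) (h1 : ∀ n ω, ξ n ω ≤ 1) {C l : ℝ}
    (hcov : ∀ m n, 1 ≤ m → m ≤ n → |cov[ξ m, ξ n; μ]| ≤ C * (√(m : ℝ) / √(n : ℝ)))
    (hmean : Tendsto (fun n => ∫ ω, ξ n ω ∂μ) atTop (𝓝 l)) :
    ∀ᵐ ω ∂μ, Tendsto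
      (fun N : ℕ => (1 / Real.log N) * ∑ n ∈ Finset.Icc 1 N, 1 / (n : ℝ) * ξ n ω) atTop (𝓝 l) := by
  have hlog2 : 0 < Real.log 2 := Real.log_pos one_lt_two
  have hL2 : ∀ n, MemLp (ξ n) 2 μ := fun n =>
    MemLp.of_bound (hmeas n).aestronglyMeasurable 1
      (Eventually.of_forall fun ω => by rw [Real.norm_of_nonneg (h0 n ω)]; exact h1 n ω)
  set T : ℕ → Ω → ℝ := fun N ω => ∑ n ∈ Finset.Icc 1 N, 1 / (n : ℝ) * ξ n ω with hT
  have hTL2 : ∀ N, MemLp (T N) 2 μ := fun N =>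
    memLp_finsetSum _ fun n _ => (hL2 n).const_mul _
  have hC : 0 ≤ C := by
    have := (abs_nonneg _).trans (hcov 1 1 le_rfl le_rfl)
    simpa using this
  -- At `N = 2 ^ (n ^ 2)` the logarithm is of order `n²` and the variance is `O(n²)`, so the
  -- normalised variance is `O(1 / n²)`, which is summable.
  set Y : ℕ → Ω → ℝ := fun n ω =>
    (T (2 ^ (n ^ 2)) ω - ∫ ω', T (2 ^ (n ^ 2)) ω' ∂μ) / ((n ^ 2 : ℕ) : ℝ) with hY
  have hYL2 : ∀ n, MemLp (Y n) 2 μ := fun n => by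
    simp only [hY, div_eq_mul_inv]
    exact ((hTL2 _).sub (memLp_const _)).mul_const _
  have hsum : Summable fun n => ∫ ω, Y n ω ^ 2 ∂μ := by
    refine Summable.of_nonneg_of_le (fun n => integral_nonneg fun ω => sq_nonneg _) (fun n => ?_)
      ((Real.summable_one_div_nat_pow.2 (one_lt_two)).mul_left (8 * C))
    have hval : ∫ ω, Y n ω ^ 2 ∂μ = Var[T (2 ^ (n ^ 2)); μ] / ((n ^ 2 : ℕ) : ℝ) ^ 2 := by
      simp only [hY, div_pow]
      rw [integral_div, variance_eq_integral (hTL2 _).aestronglyMeasurable.aemeasurable]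
    rw [hval]
    have hv := variance_logarithmic_sum_le hL2 hcov (2 ^ (n ^ 2))
    rcases Nat.eq_zero_or_pos n with rfl | hn
    · simp
    have hn1 : (1 : ℝ) ≤ n := by exact_mod_cast hn
    have hlogle : Real.log ((2 ^ (n ^ 2) : ℕ) : ℝ) ≤ n ^ 2 := by
      push_cast
      rw [Real.log_pow]
      push_cast
      have : Real.log 2 ≤ 1 := by linarith [Real.log_two_lt_d9]
      nlinarith [sq_nonneg (n : ℝ)]
    have hnn : (1 : ℝ) ≤ (n : ℝ) ^ 2 := one_le_pow₀ hn1
    have : Var[T (2 ^ (n ^ 2)); μ] ≤ 8 * C * (n : ℝ) ^ 2 := by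
      refine hv.trans ?_
      nlinarith
    calc Var[T (2 ^ (n ^ 2)); μ] / ((n ^ 2 : ℕ) : ℝ) ^ 2
        ≤ 8 * C * (n : ℝ) ^ 2 / ((n ^ 2 : ℕ) : ℝ) ^ 2 := by gcongr
      _ = 8 * C * (1 / (n : ℝ) ^ 2) := by push_cast; field_simp
  have hmeanT : Tendsto (fun n : ℕ => (∫ ω, T (2 ^ (n ^ 2)) ω ∂μ) / ((n ^ 2 : ℕ) : ℝ)) atTop
      (𝓝 (l * Real.log 2)) := by
    have hsub : Tendsto (fun n : ℕ => 2 ^ (n ^ 2)) atTop atTop :=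
      (tendsto_pow_atTop_atTop_of_one_lt (by norm_num : 1 < 2)).comp
        (tendsto_pow_atTop (by norm_num))
    have := ((tendsto_logarithmic_mean hmean).comp hsub).mul_const (Real.log 2)
    refine this.congr' ?_
    filter_upwards [eventually_ge_atTop 1] with n hn
    have hn0 : (n : ℝ) ≠ 0 := by positivity
    have hint : ∫ ω, T (2 ^ (n ^ 2)) ω ∂μ
        = ∑ j ∈ Finset.Icc (1 : ℕ) (2 ^ (n ^ 2)), 1 / (j : ℝ) * ∫ ω, ξ j ω ∂μ := by
      simp only [hT]
      rw [integral_finsetSum _ fun j _ => ((hL2 j).integrable one_le_two).const_mul _]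
      simp_rw [integral_const_mul]
    rw [hint, Function.comp_apply]
    push_cast
    rw [Real.log_pow]
    push_cast
    field_simp
  filter_upwards [ae_tendsto_zero_of_summable_integral_sq hYL2 hsum] with ω hω
  refine tendsto_div_log_of_dyadic (T := fun N => T N ω) ?_ ?_ ?_
  · intro a b hab
    exact Finset.sum_le_sum_of_subset_of_nonneg (Finset.Icc_subset_Icc_right hab)
      fun n _ _ => mul_nonneg (by positivity) (h0 n ω)
  · exact fun n => Finset.sum_nonneg fun n _ => mul_nonneg (by positivity) (h0 n ω)
  · have := hω.add hmeanT
    rw [zero_add] at this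
    refine this.congr fun n => ?_
    simp only [hY]
    ring

end StrongLaw

/-! ### Blocks of indices and their independence -/

/-- The σ-algebra generated by the variables with index in `s`. -/
abbrev blockSigma {Ω : Type*} (X : ℕ → Ω → ℝ) (s : Finset ℕ) : MeasurableSpace Ω :=
  ⨆ i ∈ (s : Set ℕ), MeasurableSpace.comap (X i) inferInstance

/-- The event that, for each `j`, at most `r j` of the variables with index in `s` exceed `v j`. -/
def fewExceed {Ω ι : Type*} (X : ℕ → Ω → ℝ) (v : ι → ℝ) (r : ι → ℕ) (s : Finset ℕ) : Set Ω :=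
  {ω | ∀ j, exceedCount X s (v j) ω ≤ r j}

section Blocks

variable {Ω : Type*} {X : ℕ → Ω → ℝ}

theorem measurable_blockSigma {s : Finset ℕ} {i : ℕ} (hi : i ∈ s) :
    Measurable[blockSigma X s] (X i) :=
  Measurable.mono (comap_measurable (X i))
    (le_iSup₂_of_le (f := fun i (_ : i ∈ (s : Set ℕ)) =>
      MeasurableSpace.comap (X i) inferInstance) i hi le_rfl) le_rfl

theorem measurable_sum_blockSigma (s : Finset ℕ) :
    Measurable[blockSigma X s] (fun ω => ∑ i ∈ s, X i ω) :=
  Finset.measurable_fun_sum s fun _ hi => measurable_blockSigma hi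

theorem measurable_exceedCount_blockSigma (s : Finset ℕ) (v : ℝ) :
    Measurable[blockSigma X s] (exceedCount X s v) := by
  have : exceedCount X s v = fun ω => ∑ i ∈ s, (Set.Ioi v).indicator (fun _ => 1) (X i ω) :=
    funext (exceedCount_eq_sum X s v)
  rw [this]
  exact Finset.measurable_fun_sum s fun i hi =>
    (measurable_const.indicator measurableSet_Ioi).comp (measurable_blockSigma hi)

theorem measurableSet_fewExceed_blockSigma {ι : Type*} [Finite ι] (v : ι → ℝ) (r : ι → ℕ)
    (s : Finset ℕ) : MeasurableSet[blockSigma X s] (fewExceed X v r s) := by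
  have : fewExceed X v r s = ⋂ j, exceedCount X s (v j) ⁻¹' Set.Iic (r j) := by
    ext ω; simp [fewExceed]
  rw [this]
  exact MeasurableSet.iInter fun j => measurable_exceedCount_blockSigma s (v j) measurableSet_Iic

theorem exceedCount_add (v : ℝ) {m n : ℕ} (hmn : m ≤ n) (ω : Ω) :
    exceedCount X (Finset.range m) v ω + exceedCount X (Finset.Ico m n) v ω
      = exceedCount X (Finset.range n) v ω := by
  simp only [exceedCount_eq_sum]
  exact Finset.sum_range_add_sum_Ico _ hmn

theorem fewExceed_range_subset {ι : Type*} (v : ι → ℝ) (r : ι → ℕ) {m n : ℕ} (hmn : m ≤ n) :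
    fewExceed X v r (Finset.range n) ⊆ fewExceed X v r (Finset.Ico m n) := fun ω hω j => by
  have := hω j
  have := exceedCount_add (X := X) (v j) hmn ω
  omega

variable [MeasurableSpace Ω] {μ : Measure Ω}

theorem blockSigma_le (hmeas : ∀ i, Measurable (X i)) (s : Finset ℕ) :
    blockSigma X s ≤ ‹MeasurableSpace Ω› :=
  iSup₂_le fun i _ => (hmeas i).comap_le

theorem measurable_exceedCount (hmeas : ∀ i, Measurable (X i)) (s : Finset ℕ) (v : ℝ) :
    Measurable (exceedCount X s v) :=
  (measurable_exceedCount_blockSigma s v).mono (blockSigma_le hmeas s) le_rfl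

theorem measurableSet_fewExceed {ι : Type*} [Finite ι] (hmeas : ∀ i, Measurable (X i))
    (v : ι → ℝ) (r : ι → ℕ) (s : Finset ℕ) : MeasurableSet (fewExceed X v r s) :=
  blockSigma_le hmeas s _ (measurableSet_fewExceed_blockSigma v r s)

theorem indep_blockSigma (hmeas : ∀ i, Measurable (X i)) (hindep : iIndepFun X μ)
    {s t : Finset ℕ} (hst : Disjoint s t) : Indep (blockSigma X s) (blockSigma X t) μ :=
  indep_iSup_of_disjoint (fun i => (hmeas i).comap_le) hindep (by exact_mod_cast hst)

theorem indepFun_of_blockSigma (hmeas : ∀ i, Measurable (X i)) (hindep : iIndepFun X μ)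
    {s t : Finset ℕ} (hst : Disjoint s t) {U V : Ω → ℝ} (hU : Measurable[blockSigma X s] U)
    (hV : Measurable[blockSigma X t] V) : IndepFun U V μ :=
  indep_of_indep_of_le (indep_blockSigma hmeas hindep hst) hU.comap_le hV.comap_le

theorem disjoint_range_Ico (m n : ℕ) : Disjoint (Finset.range m) (Finset.Ico m n) := by
  rw [Finset.disjoint_left]
  intro i hi hi'
  simp at hi hi'
  omega

end Blocks

/-! ### Tail bounds for exceedance counts -/

section TailBounds

theorem measureReal_lt_eq {Ω : Type*} [MeasurableSpace Ω] {μ : Measure Ω}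
    {X : ℕ → Ω → ℝ} (hident : ∀ i, IdentDistrib (X i) (X 0) μ μ) (v : ℝ) (i : ℕ) :
    μ.real {ω | v < X i ω} = μ.real {ω | v < X 0 ω} := by
  have := (hident i).measure_mem_eq (measurableSet_Ioi (a := v))
  simp only [measureReal_def]
  exact congrArg ENNReal.toReal this

variable {Ω : Type*} [MeasurableSpace Ω] {μ : Measure Ω} [IsProbabilityMeasure μ]
  {X : ℕ → Ω → ℝ}

theorem measureReal_one_le_exceedCount (hident : ∀ i, IdentDistrib (X i) (X 0) μ μ)
    (s : Finset ℕ) (v : ℝ) :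
    μ.real {ω | 1 ≤ exceedCount X s v ω} ≤ s.card * μ.real {ω | v < X 0 ω} := by
  have hsub : {ω | 1 ≤ exceedCount X s v ω} ⊆ ⋃ i ∈ s, {ω | v < X i ω} := by
    intro ω hω
    simp only [Set.mem_ofPred_eq, exceedCount, Nat.one_le_iff_ne_zero, Finset.card_ne_zero] at hω
    obtain ⟨i, hi⟩ := hω
    rw [Finset.mem_filter] at hi
    exact Set.mem_biUnion hi.1 hi.2
  calc μ.real {ω | 1 ≤ exceedCount X s v ω} ≤ μ.real (⋃ i ∈ s, {ω | v < X i ω}) :=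
        measureReal_mono hsub (measure_ne_top _ _)
    _ ≤ ∑ i ∈ s, μ.real {ω | v < X i ω} := measureReal_biUnion_finset_le _ _
    _ = s.card * μ.real {ω | v < X 0 ω} := by simp [measureReal_lt_eq hident]

/-- The generating function of a binomial count, factorised by independence. It is used with `c = 0`
for the probability of no exceedance and with `c = 1 / 2` for a lower tail bound. -/
theorem integral_pow_exceedCount (hmeas : ∀ i, Measurable (X i)) (hindep : iIndepFun X μ)
    (hident : ∀ i, IdentDistrib (X i) (X 0) μ μ) (s : Finset ℕ) (v c : ℝ) :
    ∫ ω, c ^ exceedCount X s v ω ∂μ = (1 - (1 - c) * μ.real {ω | v < X 0 ω}) ^ s.card := by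
  have hh : Measurable (fun x : ℝ => c ^ ((Set.Ioi v).indicator (fun _ => 1) x : ℕ)) :=
    (measurable_of_countable (fun n : ℕ => c ^ n)).comp
      (measurable_const.indicator measurableSet_Ioi)
  have hone : ∀ i, ∫ ω, c ^ ((Set.Ioi v).indicator (fun _ => 1) (X i ω) : ℕ) ∂μ
      = 1 - (1 - c) * μ.real {ω | v < X 0 ω} := by
    intro i
    have hset : MeasurableSet {ω | v < X i ω} := measurableSet_lt measurable_const (hmeas i)
    have : ∀ ω, c ^ ((Set.Ioi v).indicator (fun _ => 1) (X i ω) : ℕ)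
        = 1 - (1 - c) * {ω | v < X i ω}.indicator (fun _ => (1 : ℝ)) ω := by
      intro ω
      by_cases h : v < X i ω <;> simp [h]
    simp_rw [this]
    rw [integral_sub (integrable_const _)
      (((integrable_const (1 : ℝ)).indicator hset).const_mul _), integral_const_mul,
      integral_indicator_const _ hset, measureReal_lt_eq hident]
    simp
  have hprod := (hindep.restrict s).integral_fun_prod_comp (fun i => (hmeas i).aemeasurable)
    (f := fun _ x => c ^ ((Set.Ioi v).indicator (fun _ => 1) x : ℕ))
    (fun i => hh.aestronglyMeasurable)
  simp only [Finset.restrict] at hprod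
  simp_rw [hone] at hprod
  rw [Finset.prod_const, Finset.card_univ, Fintype.card_coe] at hprod
  rw [← hprod]
  refine integral_congr_ae (Eventually.of_forall fun ω => ?_)
  simp only [exceedCount_eq_sum, ← Finset.prod_pow_eq_pow_sum]
  exact (Finset.prod_coe_sort s fun i =>
    c ^ ((Set.Ioi v).indicator (fun _ => 1) (X i ω) : ℕ)).symm

theorem measureReal_exceedCount_le_zero (hmeas : ∀ i, Measurable (X i)) (hindep : iIndepFun X μ)
    (hident : ∀ i, IdentDistrib (X i) (X 0) μ μ) (s : Finset ℕ) (v : ℝ) :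
    μ.real {ω | exceedCount X s v ω ≤ 0} = (1 - μ.real {ω | v < X 0 ω}) ^ s.card := by
  have hset : MeasurableSet {ω | exceedCount X s v ω ≤ 0} :=
    measurable_exceedCount hmeas s v measurableSet_Iic
  -- Since `0 ^ 0 = 1`, the variable `0 ^ count` is the indicator of no exceedance.
  have h := integral_pow_exceedCount hmeas hindep hident s v 0
  rw [sub_zero, one_mul] at h
  rw [← h, ← integral_indicator_one hset]
  refine integral_congr_ae (Eventually.of_forall fun ω => ?_)
  by_cases hω : exceedCount X s v ω = 0 <;> simp [hω]

/-- A lower tail bound for the number of exceedances. -/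
theorem measureReal_exceedCount_le_mul (hmeas : ∀ i, Measurable (X i)) (hindep : iIndepFun X μ)
    (hident : ∀ i, IdentDistrib (X i) (X 0) μ μ) (s : Finset ℕ) (v : ℝ) (r : ℕ) :
    μ.real {ω | exceedCount X s v ω ≤ r} * (s.card * μ.real {ω | v < X 0 ω}) ≤ 2 ^ (r + 1) := by
  set p := μ.real {ω | v < X 0 ω} with hp
  have hp0 : 0 ≤ p := measureReal_nonneg
  have hp1 : p ≤ 1 := measureReal_le_one
  have hset : MeasurableSet {ω | exceedCount X s v ω ≤ r} :=
    measurable_exceedCount hmeas s v measurableSet_Iic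
  have hint : Integrable (fun ω => (1 / 2 : ℝ) ^ exceedCount X s v ω) μ := by
    refine Integrable.of_bound ((measurable_of_countable (fun n : ℕ => (1 / 2 : ℝ) ^ n)).comp
      (measurable_exceedCount hmeas s v)).aestronglyMeasurable 1 (Eventually.of_forall fun ω => ?_)
    rw [Real.norm_of_nonneg (by positivity)]
    exact pow_le_one₀ (by norm_num) (by norm_num)
  -- Markov's inequality for `(1 / 2) ^ count`, which is at least `2 ^ (-r)` on the event.
  have hmarkov : μ.real {ω | exceedCount X s v ω ≤ r} ≤ 2 ^ r * (1 - p / 2) ^ s.card := by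
    rw [show 1 - p / 2 = 1 - (1 - 1 / 2) * p by ring,
      ← integral_pow_exceedCount hmeas hindep hident, ← integral_const_mul,
      ← integral_indicator_one hset]
    refine integral_mono ((integrable_const (1 : ℝ)).indicator hset) (hint.const_mul _) fun ω => ?_
    by_cases h : exceedCount X s v ω ≤ r
    · rw [Set.indicator_of_mem (by exact h)]
      calc (1 : ℝ) = 2 ^ r * (1 / 2) ^ r := by rw [← mul_pow]; norm_num
        _ ≤ 2 ^ r * (1 / 2) ^ exceedCount X s v ω := by
          gcongr ?_ * ?_
          exact pow_le_pow_of_le_one (by norm_num) (by norm_num) h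
    · rw [Set.indicator_of_notMem (by exact h)]
      positivity
  have hexp : (1 - p / 2) ^ s.card ≤ Real.exp (-(s.card * (p / 2))) := by
    rw [← mul_neg, Real.exp_nat_mul]
    exact pow_le_pow_left₀ (by linarith) (by linarith [Real.add_one_le_exp (-(p / 2))]) _
  have hxe : Real.exp (-(s.card * (p / 2))) * (s.card * (p / 2)) ≤ 1 := by
    rw [Real.exp_neg, inv_mul_le_iff₀ (Real.exp_pos _)]
    linarith [Real.add_one_le_exp (s.card * (p / 2))]
  calc μ.real {ω | exceedCount X s v ω ≤ r} * (s.card * p)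
      ≤ (2 ^ r * Real.exp (-(s.card * (p / 2)))) * (s.card * p) := by
        gcongr
        exact hmarkov.trans (by gcongr)
    _ = 2 ^ (r + 1) * (Real.exp (-(s.card * (p / 2))) * (s.card * (p / 2))) := by ring
    _ ≤ 2 ^ (r + 1) * 1 := by gcongr
    _ = 2 ^ (r + 1) := mul_one _

/-- On the difference, some level `v j` is exceeded among the first `m` indices while the later
block has at most `r j` exceedances. These events are independent, with probabilities at most `m p`
and `2 ^ (r j + 1) / ((n - m) p)`. The exceedance probability `p` cancels, so the bound is uniform
in the levels. -/
theorem measureReal_fewExceed_diff_mul {ι : Type*} [Fintype ι] (hmeas : ∀ i, Measurable (X i))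
    (hindep : iIndepFun X μ) (hident : ∀ i, IdentDistrib (X i) (X 0) μ μ) (v : ι → ℝ) (r : ι → ℕ)
    {m n : ℕ} (hmn : m ≤ n) :
    μ.real (fewExceed X v r (Finset.Ico m n) \ fewExceed X v r (Finset.range n)) * (n - m : ℝ)
      ≤ (∑ j, 2 ^ (r j + 1)) * m := by
  set E : ι → Set Ω := fun j => {ω | 1 ≤ exceedCount X (Finset.range m) (v j) ω} ∩
    {ω | exceedCount X (Finset.Ico m n) (v j) ω ≤ r j} with hE
  have hnm : (0 : ℝ) ≤ n - m := sub_nonneg.2 (by exact_mod_cast hmn)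
  have hsub : fewExceed X v r (Finset.Ico m n) \ fewExceed X v r (Finset.range n) ⊆ ⋃ j, E j := by
    rintro ω ⟨h1, h2⟩
    simp only [fewExceed, Set.mem_ofPred_eq, not_forall, not_le] at h1 h2
    obtain ⟨j, hj⟩ := h2
    rw [Set.mem_iUnion]
    have := exceedCount_add (X := X) (v j) hmn ω
    have h1j := h1 j
    exact ⟨j, by simp only [Set.mem_ofPred_eq]; omega, h1j⟩
  have hEj : ∀ j, μ.real (E j) * (n - m : ℝ) ≤ 2 ^ (r j + 1) * m := by
    intro j
    have hind : μ.real (E j) = μ.real {ω | 1 ≤ exceedCount X (Finset.range m) (v j) ω} *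
        μ.real {ω | exceedCount X (Finset.Ico m n) (v j) ω ≤ r j} := by
      have := (Indep_iff _ _ μ).1
        (indep_blockSigma hmeas hindep (disjoint_range_Ico m n)) _ _
        (measurable_exceedCount_blockSigma (Finset.range m) (v j) (measurableSet_Ici (a := 1)))
        (measurable_exceedCount_blockSigma (Finset.Ico m n) (v j) (measurableSet_Iic (a := r j)))
      simp only [measureReal_def, ← ENNReal.toReal_mul]
      exact congrArg ENNReal.toReal this
    have h1 := measureReal_one_le_exceedCount hident (Finset.range m) (v j)
    have h2 := measureReal_exceedCount_le_mul hmeas hindep hident (Finset.Ico m n) (v j) (r j)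
    rw [Nat.card_Ico, Nat.cast_sub hmn] at h2
    rw [Finset.card_range] at h1
    rw [hind]
    set q := μ.real {ω | exceedCount X (Finset.Ico m n) (v j) ω ≤ r j}
    set p := μ.real {ω | v j < X 0 ω}
    have hq : 0 ≤ q := measureReal_nonneg
    calc μ.real {ω | 1 ≤ exceedCount X (Finset.range m) (v j) ω} * q * (n - m : ℝ)
        ≤ (m * p) * q * (n - m : ℝ) := by gcongr
      _ = (q * ((n - m : ℝ) * p)) * m := by ring
      _ ≤ 2 ^ (r j + 1) * m := by gcongr
  calc μ.real (fewExceed X v r (Finset.Ico m n) \ fewExceed X v r (Finset.range n)) * (n - m : ℝ)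
      ≤ (∑ j, μ.real (E j)) * (n - m : ℝ) := by
        gcongr
        exact (measureReal_mono hsub (measure_ne_top _ _)).trans (measureReal_iUnion_fintype_le _)
    _ = ∑ j, μ.real (E j) * (n - m : ℝ) := by rw [Finset.sum_mul]
    _ ≤ ∑ j, 2 ^ (r j + 1) * (m : ℝ) := Finset.sum_le_sum fun j _ => hEj j
    _ = (∑ j, 2 ^ (r j + 1)) * m := by rw [Finset.sum_mul]

end TailBounds

/-! ### Covariance decay -/

section Covariance

variable {Ω : Type*} [MeasurableSpace Ω] {μ : Measure Ω} [IsProbabilityMeasure μ]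

/-- Independence of `U` and `W` allows `V` to be replaced by `V - W` in the covariance; boundedness
of `U` does the rest. -/
theorem abs_covariance_le_of_indepFun {U V W : Ω → ℝ} (hU : Measurable U) (hV : Measurable V)
    (hW : Measurable W) (hU1 : ∀ ω, U ω ∈ Set.Icc (0 : ℝ) 1) (hV1 : ∀ ω, V ω ∈ Set.Icc (0 : ℝ) 1)
    (hW1 : ∀ ω, W ω ∈ Set.Icc (0 : ℝ) 1) (hUW : IndepFun U W μ) :
    |cov[U, V; μ]| ≤ 2 * ∫ ω, |V ω - W ω| ∂μ := by
  have hL2 : ∀ {Z : Ω → ℝ}, Measurable Z → (∀ ω, Z ω ∈ Set.Icc (0 : ℝ) 1) → MemLp Z 2 μ :=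
    fun hZ hZ1 => MemLp.of_bound hZ.aestronglyMeasurable 1
      (Eventually.of_forall fun ω => by rw [Real.norm_of_nonneg (hZ1 ω).1]; exact (hZ1 ω).2)
  have hcov : cov[U, V; μ] = cov[U, V - W; μ] := by
    rw [covariance_sub_right (hL2 hU hU1) (hL2 hV hV1) (hL2 hW hW1),
      hUW.covariance_eq_zero (hL2 hU hU1) (hL2 hW hW1), sub_zero]
  have hD : Integrable (fun ω => V ω - W ω) μ :=
    ((hL2 hV hV1).sub (hL2 hW hW1)).integrable one_le_two
  have hEU0 : 0 ≤ ∫ ω, U ω ∂μ := integral_nonneg fun ω => (hU1 ω).1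
  have hEU1 : ∫ ω, U ω ∂μ ≤ 1 := by
    calc ∫ ω, U ω ∂μ ≤ ∫ _, (1 : ℝ) ∂μ := integral_mono ((hL2 hU hU1).integrable one_le_two)
          (integrable_const _) fun ω => (hU1 ω).2
      _ = 1 := by simp
  rw [hcov, covariance_eq_sub (hL2 hU hU1) ((hL2 hV hV1).sub (hL2 hW hW1))]
  have h1 : |∫ ω, (U * (V - W)) ω ∂μ| ≤ ∫ ω, |V ω - W ω| ∂μ := by
    refine (abs_integral_le_integral_abs).trans (integral_mono_of_nonneg
      (Eventually.of_forall fun ω => abs_nonneg _) hD.abs (Eventually.of_forall fun ω => ?_))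
    simp only [Pi.mul_apply, Pi.sub_apply, abs_mul, abs_of_nonneg (hU1 ω).1]
    exact mul_le_of_le_one_left (abs_nonneg _) (hU1 ω).2
  have h2 : |∫ ω, (V - W) ω ∂μ| ≤ ∫ ω, |V ω - W ω| ∂μ := abs_integral_le_integral_abs
  have h3 : |(∫ ω, U ω ∂μ) * ∫ ω, (V - W) ω ∂μ| ≤ ∫ ω, |V ω - W ω| ∂μ := by
    rw [abs_mul, abs_of_nonneg hEU0]
    exact (mul_le_of_le_one_left (abs_nonneg _) hEU1).trans h2
  calc _ ≤ |∫ ω, (U * (V - W)) ω ∂μ| + |(∫ ω, U ω ∂μ) * ∫ ω, (V - W) ω ∂μ| := abs_sub _ _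
    _ ≤ _ := by linarith

variable {X : ℕ → Ω → ℝ}

/-- The second moment of the sum is `m`; nonnegativity of the variance of its absolute value serves
as Cauchy–Schwarz. -/
theorem integral_abs_sum_le_sqrt (hmeas : ∀ i, Measurable (X i)) (hindep : iIndepFun X μ)
    (hident : ∀ i, IdentDistrib (X i) (X 0) μ μ) (hmean : ∫ ω, X 0 ω ∂μ = 0)
    (hvar : ∫ ω, X 0 ω ^ 2 ∂μ = 1) (hL2 : ∀ i, MemLp (X i) 2 μ) (m : ℕ) :
    ∫ ω, |partialSum X m ω| ∂μ ≤ √(m : ℝ) := by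
  have hS : MemLp (partialSum X m) 2 μ := memLp_finsetSum _ fun i _ => hL2 i
  have hEi : ∀ i, ∫ ω, X i ω ∂μ = 0 := fun i => (hident i).integral_eq.trans hmean
  have hvari : ∀ i, Var[X i; μ] = 1 := fun i => by
    rw [(hident i).variance_eq, variance_of_integral_eq_zero (hmeas 0).aemeasurable hmean, hvar]
  have hES : ∫ ω, partialSum X m ω ∂μ = 0 := by
    simp only [partialSum]
    rw [integral_finsetSum _ fun i _ => (hL2 i).integrable one_le_two]
    simp [hEi]
  have hES2 : ∫ ω, partialSum X m ω ^ 2 ∂μ = m := by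
    rw [← variance_of_integral_eq_zero hS.aestronglyMeasurable.aemeasurable hES]
    have h := IndepFun.variance_sum (s := Finset.range m) (fun i _ => hL2 i)
      (fun i _ j _ hij => hindep.indepFun hij)
    have hfun : partialSum X m = ∑ i ∈ Finset.range m, X i := by
      ext ω; simp [partialSum]
    rw [hfun, h]
    simp [hvari]
  have hv := variance_nonneg (fun ω => |partialSum X m ω|) μ
  rw [variance_eq_sub (X := fun ω => |partialSum X m ω|) hS.abs] at hv
  simp only [Pi.pow_apply, sq_abs, hES2] at hv
  exact Real.le_sqrt_of_sq_le (by linarith)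

/-- Dropping the first `m` indices from the later variable changes the indicator only on a set of
probability `O(m / n)`, and changes the argument of the Lipschitz function by `S_m / √n`, whose mean
size is at most `√(m / n)`. -/
theorem abs_covariance_fewExceed_le {ι : Type*} [Fintype ι] (hmeas : ∀ i, Measurable (X i))
    (hindep : iIndepFun X μ) (hident : ∀ i, IdentDistrib (X i) (X 0) μ μ)
    (hmean : ∫ ω, X 0 ω ∂μ = 0) (hvar : ∫ ω, X 0 ω ^ 2 ∂μ = 1) (hL2 : ∀ i, MemLp (X i) 2 μ)
    (v : ℕ → ι → ℝ) (r : ι → ℕ) {f : ℝ → ℝ} (hf : ∀ x, f x ∈ Set.Icc (0 : ℝ) 1) {L : ℝ}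
    (hL0 : 0 ≤ L) (hL : ∀ x y, |f x - f y| ≤ L * |x - y|) (hfm : Measurable f) {m n : ℕ}
    (hm : 1 ≤ m) (hmn : m ≤ n) :
    |cov[fun ω => (fewExceed X (v m) r (Finset.range m)).indicator (fun _ => 1) ω *
          f (partialSum X m ω / √(m : ℝ)),
        fun ω => (fewExceed X (v n) r (Finset.range n)).indicator (fun _ => 1) ω *
          f (partialSum X n ω / √(n : ℝ)); μ]|
      ≤ (4 * (∑ j, 2 ^ (r j + 1)) + 2 * L + 4) * (√(m : ℝ) / √(n : ℝ)) := by
  have hm0 : (0 : ℝ) < m := by exact_mod_cast hm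
  have hn0 : (0 : ℝ) < n := by exact_mod_cast hm.trans hmn
  have hsm : 0 < √(m : ℝ) := Real.sqrt_pos.2 hm0
  have hsn : 0 < √(n : ℝ) := Real.sqrt_pos.2 hn0
  have hmR : √(m : ℝ) * √(m : ℝ) = m := Real.mul_self_sqrt hm0.le
  have hnR : √(n : ℝ) * √(n : ℝ) = n := Real.mul_self_sqrt hn0.le
  set K : ℝ := ∑ j, 2 ^ (r j + 1) with hK
  have hK0 : 0 ≤ K := Finset.sum_nonneg fun j _ => by positivity
  have hI01 : ∀ (s : Set Ω) (g : Ω → ℝ) (_ : ∀ ω, g ω ∈ Set.Icc (0 : ℝ) 1) (ω : Ω),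
      s.indicator (fun _ => (1 : ℝ)) ω * g ω ∈ Set.Icc (0 : ℝ) 1 := by
    intro s g hg ω
    by_cases h : ω ∈ s
    · simpa [h] using hg ω
    · simp [h]
  have hblock : ∀ (w : ι → ℝ) (s : Finset ℕ) (c : ℝ), Measurable[blockSigma X s] (fun ω =>
      (fewExceed X w r s).indicator (fun _ => (1 : ℝ)) ω * f ((∑ i ∈ s, X i ω) / c)) := by
    intro w s c
    exact (measurable_const.indicator (measurableSet_fewExceed_blockSigma w r s)).mul
      (hfm.comp ((measurable_sum_blockSigma s).div_const c))
  set U : Ω → ℝ := fun ω => (fewExceed X (v m) r (Finset.range m)).indicator (fun _ => 1) ω *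
          f (partialSum X m ω / √(m : ℝ)) with hUdef
  set V : Ω → ℝ := fun ω => (fewExceed X (v n) r (Finset.range n)).indicator (fun _ => 1) ω *
          f (partialSum X n ω / √(n : ℝ)) with hVdef
  have hUb : Measurable[blockSigma X (Finset.range m)] U := hblock _ _ _
  have hU : Measurable U := hUb.mono (blockSigma_le hmeas _) le_rfl
  have hV : Measurable V := (hblock (v n) (Finset.range n) _).mono (blockSigma_le hmeas _) le_rfl
  have hU1 : ∀ ω, U ω ∈ Set.Icc (0 : ℝ) 1 := hI01 _ _ fun ω => hf _
  have hV1 : ∀ ω, V ω ∈ Set.Icc (0 : ℝ) 1 := hI01 _ _ fun ω => hf _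
  -- The gap `n - m ≥ n / 2` turns the factor `m / (n - m)` into `2 m / n`.
  rcases le_total (2 * m) n with h2 | h2
  · set W : Ω → ℝ := fun ω => (fewExceed X (v n) r (Finset.Ico m n)).indicator (fun _ => 1) ω *
          f ((∑ i ∈ Finset.Ico m n, X i ω) / √(n : ℝ)) with hWdef
    have hWb : Measurable[blockSigma X (Finset.Ico m n)] W := hblock _ _ _
    have hW : Measurable W := hWb.mono (blockSigma_le hmeas _) le_rfl
    have hW1 : ∀ ω, W ω ∈ Set.Icc (0 : ℝ) 1 := hI01 _ _ fun ω => hf _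
    have hcov := abs_covariance_le_of_indepFun hU hV hW hU1 hV1 hW1
      (indepFun_of_blockSigma hmeas hindep (disjoint_range_Ico m n) hUb hWb)
    set D := fewExceed X (v n) r (Finset.Ico m n) \ fewExceed X (v n) r (Finset.range n) with hD
    have hDm : MeasurableSet D :=
      (measurableSet_fewExceed hmeas _ _ _).diff (measurableSet_fewExceed hmeas _ _ _)
    have hpt : ∀ ω, |V ω - W ω| ≤ D.indicator (fun _ => (1 : ℝ)) ω +
        L / √(n : ℝ) * |partialSum X m ω| := by
      intro ω
      have hsplit : partialSum X n ω / √(n : ℝ) - (∑ i ∈ Finset.Ico m n, X i ω) / √(n : ℝ)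
          = partialSum X m ω / √(n : ℝ) := by
        simp only [partialSum]
        rw [← Finset.sum_range_add_sum_Ico _ hmn]
        ring
      have hfd : |f (partialSum X n ω / √(n : ℝ)) - f ((∑ i ∈ Finset.Ico m n, X i ω) / √(n : ℝ))|
          ≤ L / √(n : ℝ) * |partialSum X m ω| := by
        refine (hL _ _).trans_eq ?_
        rw [hsplit, abs_div, abs_of_pos hsn]
        ring
      by_cases hA : ω ∈ fewExceed X (v n) r (Finset.range n)
      · have hA' := fewExceed_range_subset (v n) r hmn hA
        have hnD : ω ∉ D := fun h => h.2 hA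
        simp only [hVdef, hWdef, Set.indicator_of_mem hA, Set.indicator_of_mem hA',
          Set.indicator_of_notMem hnD, one_mul, zero_add]
        exact hfd
      · have hnn : 0 ≤ L / √(n : ℝ) * |partialSum X m ω| := by positivity
        by_cases hA' : ω ∈ fewExceed X (v n) r (Finset.Ico m n)
        · have hDω : ω ∈ D := ⟨hA', hA⟩
          simp only [hVdef, hWdef, Set.indicator_of_mem hA', Set.indicator_of_notMem hA,
            Set.indicator_of_mem hDω, zero_mul, one_mul, zero_sub, abs_neg]
          rw [abs_of_nonneg (hf _).1]
          linarith [(hf ((∑ i ∈ Finset.Ico m n, X i ω) / √(n : ℝ))).2]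
        · have hnD : ω ∉ D := fun h => hA' h.1
          simp only [hVdef, hWdef, Set.indicator_of_notMem hA', Set.indicator_of_notMem hA,
            Set.indicator_of_notMem hnD, zero_mul, sub_zero, abs_zero, zero_add]
          exact hnn
    have hSint : Integrable (fun ω => |partialSum X m ω|) μ :=
      (integrable_finsetSum _ fun i _ => (hL2 i).integrable one_le_two).abs
    have hEint : ∫ ω, |V ω - W ω| ∂μ ≤ μ.real D + L / √(n : ℝ) * √(m : ℝ) := by
      calc ∫ ω, |V ω - W ω| ∂μ ≤ ∫ ω, (D.indicator (fun _ => (1 : ℝ)) ω +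
            L / √(n : ℝ) * |partialSum X m ω|) ∂μ :=
            integral_mono_of_nonneg (Eventually.of_forall fun ω => abs_nonneg _)
              (((integrable_const (1 : ℝ)).indicator hDm).add (hSint.const_mul _))
              (Eventually.of_forall hpt)
        _ = μ.real D + L / √(n : ℝ) * ∫ ω, |partialSum X m ω| ∂μ := by
            rw [integral_add ((integrable_const (1 : ℝ)).indicator hDm) (hSint.const_mul _),
              integral_const_mul, integral_indicator_const _ hDm]
            simp
        _ ≤ _ := by
            gcongr
            exact integral_abs_sum_le_sqrt hmeas hindep hident hmean hvar hL2 m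
    have hDle : μ.real D ≤ 2 * K * (√(m : ℝ) / √(n : ℝ)) := by
      have h := measureReal_fewExceed_diff_mul hmeas hindep hident (v n) r hmn
      rw [← hD, ← hK] at h
      have h2R : (2 * m : ℝ) ≤ n := by exact_mod_cast h2
      have hD0 : 0 ≤ μ.real D := measureReal_nonneg
      have h3 : μ.real D * n ≤ 2 * K * m := by nlinarith
      have hmnle : √(m : ℝ) ≤ √(n : ℝ) := Real.sqrt_le_sqrt (by exact_mod_cast hmn)
      have h4 : μ.real D ≤ 2 * K * (m / n) := by
        rw [← mul_div_assoc, le_div_iff₀ hn0]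
        exact h3
      have h5 : (m : ℝ) / n ≤ √(m : ℝ) / √(n : ℝ) := by
        rw [div_le_div_iff₀ hn0 hsn]
        calc (m : ℝ) * √(n : ℝ) = √(m : ℝ) * (√(m : ℝ) * √(n : ℝ)) := by rw [← mul_assoc, hmR]
          _ ≤ √(m : ℝ) * (√(n : ℝ) * √(n : ℝ)) := by gcongr
          _ = √(m : ℝ) * n := by rw [hnR]
      exact h4.trans (by gcongr)
    calc |cov[U, V; μ]| ≤ 2 * (2 * K * (√(m : ℝ) / √(n : ℝ)) + L / √(n : ℝ) * √(m : ℝ)) := by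
          linarith
      _ = (4 * K + 2 * L) * (√(m : ℝ) / √(n : ℝ)) := by ring
      _ ≤ _ := mul_le_mul_of_nonneg_right (by linarith) (by positivity)
  -- For `n ≤ 2 m`, comparison with the constant `0` gives the trivial bound `2`, and `2 ≤ 4 √(m /
  -- n)`.
  · have hcov := abs_covariance_le_of_indepFun hU hV (measurable_const (a := (0 : ℝ))) hU1 hV1
      (fun ω => by simp) (indepFun_const_right (μ := μ) U (0 : ℝ))
    have hV0 : ∫ ω, |V ω - 0| ∂μ ≤ 1 := by
      calc ∫ ω, |V ω - 0| ∂μ ≤ ∫ _, (1 : ℝ) ∂μ :=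
            integral_mono_of_nonneg (Eventually.of_forall fun ω => abs_nonneg _)
              (integrable_const _) (Eventually.of_forall fun ω => by
                simp only [sub_zero, abs_of_nonneg (hV1 ω).1]; exact (hV1 ω).2)
        _ = 1 := by simp
    have hratio : 1 ≤ 2 * (√(m : ℝ) / √(n : ℝ)) := by
      rw [← mul_div_assoc, le_div_iff₀ hsn, one_mul]
      have : √(n : ℝ) ≤ √(4 * m : ℝ) := by
        refine Real.sqrt_le_sqrt ?_
        have : (n : ℝ) ≤ 2 * m := by exact_mod_cast h2
        linarith
      rwa [Real.sqrt_mul (by norm_num), show √(4 : ℝ) = 2 by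
        rw [show (4 : ℝ) = 2 ^ 2 by norm_num, Real.sqrt_sq (by norm_num)]] at this
    have hq : 0 ≤ √(m : ℝ) / √(n : ℝ) := by positivity
    calc |cov[U, V; μ]| ≤ 2 := by linarith
      _ ≤ 4 * (√(m : ℝ) / √(n : ℝ)) := by linarith
      _ ≤ _ := mul_le_mul_of_nonneg_right (by linarith) hq

end Covariance

/-! ### Lévy's continuity theorem -/

section Levy

variable {E : Type*} [NormedAddCommGroup E] [InnerProductSpace ℝ E] [FiniteDimensional ℝ E]
  [MeasurableSpace E] [BorelSpace E]

/-- Continuity of `f` at `0` gives tightness, hence by Prokhorov a limit along an ultrafilter. Its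
characteristic function must be `f`, and this identifies the limit of the whole sequence. -/
theorem exists_tendsto_of_tendsto_charFun {μ : ℕ → ProbabilityMeasure E} {f : E → ℂ}
    (hf : ContinuousAt f 0)
    (h : ∀ t, Tendsto (fun n => charFun (μ n : Measure E) t) atTop (𝓝 (f t))) :
    ∃ ρ : ProbabilityMeasure E, (∀ t, charFun (ρ : Measure E) t = f t) ∧
      Tendsto μ atTop (𝓝 ρ) := by
  have htight := isTightMeasureSet_of_tendsto_charFun (μ := fun n => (μ n : Measure E)) hf h
  have hcompact : IsCompact (closure (Set.range μ)) := by
    refine isCompact_closure_of_isTightMeasureSet ?_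
    convert htight using 1
    ext m
    simp
  let U : Ultrafilter ℕ := Ultrafilter.of atTop
  have hU : (U : Filter ℕ) ≤ atTop := Ultrafilter.of_le atTop
  obtain ⟨ρ, -, hρ⟩ := hcompact.ultrafilter_le_nhds (U.map μ)
    (le_principal_iff.2 (Ultrafilter.mem_map.2 (univ_mem' fun n =>
      subset_closure (Set.mem_range_self n))))
  have hρt : Tendsto μ U (𝓝 ρ) := hρ
  have hchar : ∀ t, charFun (ρ : Measure E) t = f t := by
    intro t
    rw [ProbabilityMeasure.tendsto_iff_forall_integral_rclike_tendsto ℂ] at hρt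
    have h1 := hρt (BoundedContinuousFunction.innerProbChar t)
    simp_rw [← charFun_eq_integral_innerProbChar] at h1
    exact tendsto_nhds_unique h1 ((h t).mono_left hU)
  refine ⟨ρ, hchar, ProbabilityMeasure.tendsto_iff_tendsto_charFun.2 fun t => ?_⟩
  rw [hchar]
  exact h t

end Levy

/-! ### One-variable contributions to sum and counts -/

section RowSteps

variable {ι : Type*}

/-- The normalised partial sum together with the vector of exceedance counts. -/
noncomputable def sumCountVector {Ω : Type*} (X : ℕ → Ω → ℝ) (v : ι → ℝ) (n : ℕ) (ω : Ω) :
    WithLp 2 (ℝ × EuclideanSpace ℝ ι) :=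
  WithLp.toLp 2 (partialSum X n ω / √(n : ℝ),
    WithLp.toLp 2 fun j => (exceedCount X (Finset.range n) (v j) ω : ℝ))

/-- The contribution of one variable with value `x` to `sumCountVector`. -/
noncomputable def sumCountStep (v : ι → ℝ) (n : ℕ) (x : ℝ) : WithLp 2 (ℝ × EuclideanSpace ℝ ι) :=
  WithLp.toLp 2 (x / √(n : ℝ), WithLp.toLp 2 fun j => (Set.Ioi (v j)).indicator (fun _ => (1 : ℝ)) x)

theorem measurable_sumCountStep (v : ι → ℝ) (n : ℕ) : Measurable (sumCountStep v n) := by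
  have h : ∀ j, Measurable fun x : ℝ => (Set.Ioi (v j)).indicator (fun _ => (1 : ℝ)) x :=
    fun j => measurable_const.indicator measurableSet_Ioi
  unfold sumCountStep
  fun_prop

theorem sumCountVector_eq_sum {Ω : Type*} (X : ℕ → Ω → ℝ) (v : ι → ℝ) (n : ℕ) (ω : Ω) :
    sumCountVector X v n ω = ∑ i ∈ Finset.range n, sumCountStep v n (X i ω) := by
  apply WithLp.ofLp_injective
  rw [WithLp.ofLp_sum]
  refine Prod.ext ?_ ?_
  · simp [sumCountVector, sumCountStep, partialSum, Finset.sum_div, Prod.fst_sum]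
  · rw [Prod.snd_sum]
    apply WithLp.ofLp_injective
    rw [WithLp.ofLp_sum]
    funext j
    simp [sumCountVector, sumCountStep, exceedCount_eq_sum, Set.indicator_apply]

variable [Fintype ι]

/-- For an indicator `χ`, `exp (i s χ) = 1 + (exp (i s) - 1) χ`; this separates the factor from the
sum from the factor from the counts. -/
theorem exp_inner_sumCountStep (v : ι → ℝ) (n : ℕ) (x : ℝ)
    (t : WithLp 2 (ℝ × EuclideanSpace ℝ ι)) :
    Complex.exp (inner ℝ (sumCountStep v n x) t * Complex.I)
      = Complex.exp (Complex.I * ((√(n : ℝ))⁻¹ * t.fst * x : ℝ)) *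
        ∏ j, (1 + (Complex.exp (Complex.I * (t.snd j : ℝ)) - 1) *
          (Set.Ioi (v j)).indicator (fun _ => (1 : ℂ)) x) := by
  have h : ∀ j, 1 + (Complex.exp (Complex.I * (t.snd j : ℝ)) - 1) *
      (Set.Ioi (v j)).indicator (fun _ => (1 : ℂ)) x
      = Complex.exp (Complex.I * (t.snd j * (Set.Ioi (v j)).indicator (fun _ => (1 : ℝ)) x : ℝ)) := by
    intro j
    by_cases hx : v j < x <;> simp [hx]
  simp_rw [h]
  rw [← Complex.exp_sum, ← Complex.exp_add]
  congr 1
  rw [WithLp.prod_inner_apply, PiLp.inner_apply]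
  simp only [sumCountStep, Real.inner_apply, WithLp.ofLp_toLp]
  push_cast
  rw [add_mul, Finset.sum_mul, mul_comm _ Complex.I]
  congr 1
  · simp only [WithLp.fst]; ring
  · exact Finset.sum_congr rfl fun j _ => by simp only [WithLp.snd]; ring

theorem norm_prod_one_add_sub_one_le (v : ι → ℝ) (s : ι → ℝ) (x : ℝ) :
    ‖∏ j, (1 + (Complex.exp (Complex.I * (s j : ℝ)) - 1) *
          (Set.Ioi (v j)).indicator (fun _ => (1 : ℂ)) x) - 1‖
      ≤ {x | ∃ j, v j < x}.indicator (fun _ => (2 : ℝ)) x := by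
  by_cases hx : ∃ j, v j < x
  · rw [Set.indicator_of_mem (by exact hx)]
    have hprod : ‖∏ j, (1 + (Complex.exp (Complex.I * (s j : ℝ)) - 1) *
          (Set.Ioi (v j)).indicator (fun _ => (1 : ℂ)) x)‖ = 1 := by
      rw [norm_prod]
      refine Finset.prod_eq_one fun j _ => ?_
      by_cases hj : v j < x
      · simp [hj, mul_comm Complex.I, Complex.norm_exp_ofReal_mul_I]
      · simp [hj]
    refine (norm_sub_le _ _).trans ?_
    rw [hprod, norm_one]
    norm_num
  · rw [Set.indicator_of_notMem (by exact hx)]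
    push Not at hx
    have : ∀ j, (Set.Ioi (v j)).indicator (fun _ => (1 : ℂ)) x = 0 := fun j =>
      Set.indicator_of_notMem (by simpa using hx j) _
    simp [this]

/-- One variable can exceed several levels at once, so the counts are dependent; the expansion over
subsets shows that only joint exceedance probabilities enter the limit. -/
theorem prod_one_add_indicator_sub_one [DecidableEq ι] (v : ι → ℝ) (c : ι → ℂ) (x : ℝ) :
    ∏ j, (1 + c j * (Set.Ioi (v j)).indicator (fun _ => (1 : ℂ)) x) - 1
      = ∑ J ∈ (Finset.univ : Finset (Finset ι)).erase ∅,
          (∏ j ∈ J, c j) * {x | ∀ j ∈ J, v j < x}.indicator (fun _ => (1 : ℂ)) x := by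
  have h : ∀ J : Finset ι, ∏ j ∈ J, c j * (Set.Ioi (v j)).indicator (fun _ => (1 : ℂ)) x
      = (∏ j ∈ J, c j) * {x | ∀ j ∈ J, v j < x}.indicator (fun _ => (1 : ℂ)) x := by
    intro J
    rw [Finset.prod_mul_distrib]
    congr 1
    by_cases hJ : ∀ j ∈ J, v j < x
    · rw [Set.indicator_of_mem (by exact hJ)]
      exact Finset.prod_eq_one fun j hj => Set.indicator_of_mem (by exact hJ j hj) _
    · rw [Set.indicator_of_notMem (by exact hJ)]
      push Not at hJ
      obtain ⟨j, hj, hjx⟩ := hJ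
      exact Finset.prod_eq_zero hj (Set.indicator_of_notMem (by simpa using hjx) _)
  rw [Finset.prod_one_add, Finset.powerset_univ, ← Finset.add_sum_erase _ _ (Finset.mem_univ ∅)]
  simp only [Finset.prod_empty, add_sub_cancel_left]
  exact Finset.sum_congr rfl fun J _ => h J

end RowSteps

/-! ### Characteristic function of the row sums -/

section CharFun

theorem measurable_sumCountVector {Ω : Type*} [MeasurableSpace Ω]
    {X : ℕ → Ω → ℝ} {ι : Type*} [Fintype ι] (hmeas : ∀ i, Measurable (X i)) (v : ι → ℝ) (n : ℕ) :
    Measurable (sumCountVector X v n) := by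
  have : sumCountVector X v n = fun ω => ∑ i ∈ Finset.range n, sumCountStep v n (X i ω) :=
    funext (sumCountVector_eq_sum X v n)
  rw [this]
  exact Finset.measurable_fun_sum _ fun i _ => (measurable_sumCountStep v n).comp (hmeas i)

theorem charFun_sumCountVector {Ω : Type*} [MeasurableSpace Ω] {μ : Measure Ω}
    {X : ℕ → Ω → ℝ} {ι : Type*} [Fintype ι] (hmeas : ∀ i, Measurable (X i)) (hindep : iIndepFun X μ)
    (hident : ∀ i, IdentDistrib (X i) (X 0) μ μ) (v : ι → ℝ) (n : ℕ)
    (t : WithLp 2 (ℝ × EuclideanSpace ℝ ι)) :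
    charFun (μ.map (sumCountVector X v n)) t
      = charFun (μ.map fun ω => sumCountStep v n (X 0 ω)) t ^ n := by
  have hfun : sumCountVector X v n = fun ω => ∑ i ∈ Finset.range n, sumCountStep v n (X i ω) :=
    funext (sumCountVector_eq_sum X v n)
  have hstep := measurable_sumCountStep v n
  have hi : iIndepFun (fun i ω => sumCountStep v n (X i ω)) μ :=
    hindep.comp (fun _ => sumCountStep v n) fun _ => hstep
  rw [hfun, iIndepFun.charFun_map_fun_finsetSum_eq_prod (X := fun i ω => sumCountStep v n (X i ω))
    (fun i _ => (hstep.comp (hmeas i)).aemeasurable) (hi.restrict _)]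
  have : ∀ i, μ.map (fun ω => sumCountStep v n (X i ω)) = μ.map fun ω => sumCountStep v n (X 0 ω) :=
    fun i => ((hident i).comp hstep).map_eq
  simp [this]

end CharFun

/-! ### Asymptotic independence of sums and counts -/

section JointLimit

variable {Ω : Type*} [MeasurableSpace Ω] {μ : Measure Ω} [IsProbabilityMeasure μ]

/-- Morally Cauchy–Schwarz: the product is at most `√(n μ(B n))` times the square root of the
integral of `Y²` over `B n`, which vanishes as `B n` shrinks. It is carried out as a weighted
arithmetic–geometric mean inequality. -/
theorem tendsto_sqrt_mul_setIntegral_abs {Y : Ω → ℝ} (hY : MemLp Y 2 μ) {B : ℕ → Set Ω} {K : ℝ}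
    (hBK : ∀ᶠ n : ℕ in atTop, n * μ.real (B n) ≤ K) :
    Tendsto (fun n : ℕ => √(n : ℝ) * ∫ ω in B n, |Y ω| ∂μ) atTop (𝓝 0) := by
  have hBreal : Tendsto (fun n => μ.real (B n)) atTop (𝓝 0) := by
    have hK : Tendsto (fun n : ℕ => K / (n : ℝ)) atTop (𝓝 0) :=
      tendsto_const_div_atTop_nhds_zero_nat K
    refine squeeze_zero' (Eventually.of_forall fun n => measureReal_nonneg) ?_ hK
    filter_upwards [hBK, eventually_ge_atTop 1] with n hn hn1
    rw [le_div_iff₀ (by exact_mod_cast hn1), mul_comm]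
    exact hn
  have hB0 : Tendsto (μ ∘ B) atTop (𝓝 0) := by
    have := ENNReal.tendsto_ofReal hBreal
    rw [ENNReal.ofReal_zero] at this
    refine this.congr fun n => ?_
    simp [measureReal_def]
  -- The summand `1 / (n + 1)` keeps `δ n` positive, so that `√(δ n)` can be a denominator.
  set δ : ℕ → ℝ := fun n => (∫ ω in B n, Y ω ^ 2 ∂μ) + 1 / ((n : ℝ) + 1) with hδ
  have hδ0 : Tendsto δ atTop (𝓝 0) := by
    simpa [hδ] using (hY.integrable_sq.tendsto_setIntegral_nhds_zero hB0).add
      (tendsto_one_div_add_atTop_nhds_zero_nat (𝕜 := ℝ))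
  have hδpos : ∀ n, 0 < δ n := fun n =>
    add_pos_of_nonneg_of_pos (integral_nonneg fun ω => sq_nonneg _) (by positivity)
  have hlim : Tendsto (fun n => √(δ n) * ((K + 1) / 2)) atTop (𝓝 0) := by
    have := hδ0.sqrt.mul_const ((K + 1) / 2)
    simpa using this
  refine squeeze_zero' (Eventually.of_forall fun n =>
    mul_nonneg (Real.sqrt_nonneg _) (integral_nonneg fun ω => abs_nonneg _)) ?_ hlim
  filter_upwards [hBK] with n hn
  have hd : 0 < √(δ n) := Real.sqrt_pos.2 (hδpos n)
  have hdd : √(δ n) * √(δ n) = δ n := Real.mul_self_sqrt (hδpos n).le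
  have hY1 : Integrable Y μ := hY.integrable one_le_two
  have hnn : √(n : ℝ) * √(n : ℝ) = n := Real.mul_self_sqrt (Nat.cast_nonneg n)
  have hpt : ∀ ω, √(n : ℝ) * |Y ω| ≤ (n * √(δ n)) / 2 + Y ω ^ 2 * (1 / (2 * √(δ n))) := by
    intro ω
    have h1 := sq_nonneg (√(n : ℝ) * √(δ n) - |Y ω|)
    have h2 : (n * √(δ n)) / 2 + Y ω ^ 2 * (1 / (2 * √(δ n)))
        = (n * (√(δ n) * √(δ n)) + |Y ω| ^ 2) / (2 * √(δ n)) := by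
      rw [sq_abs]; field_simp
    rw [h2, le_div_iff₀ (by positivity)]
    nlinarith
  calc √(n : ℝ) * ∫ ω in B n, |Y ω| ∂μ = ∫ ω in B n, √(n : ℝ) * |Y ω| ∂μ := by
        rw [integral_const_mul]
    _ ≤ ∫ ω in B n, ((n * √(δ n)) / 2 + Y ω ^ 2 * (1 / (2 * √(δ n)))) ∂μ := by
        refine integral_mono (hY1.abs.const_mul _).integrableOn
          ((integrable_const _).add (hY.integrable_sq.mul_const _)).integrableOn hpt
    _ = μ.real (B n) * ((n * √(δ n)) / 2) + (∫ ω in B n, Y ω ^ 2 ∂μ) * (1 / (2 * √(δ n))) := by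
        rw [integral_add (integrable_const _) (hY.integrable_sq.mul_const _).integrableOn,
          integral_mul_const]
        simp
    _ ≤ K * √(δ n) / 2 + δ n * (1 / (2 * √(δ n))) := by
        have : ∫ ω in B n, Y ω ^ 2 ∂μ ≤ δ n := le_add_of_nonneg_right (by positivity)
        have h3 : μ.real (B n) * ((n * √(δ n)) / 2) = n * μ.real (B n) * √(δ n) / 2 := by ring
        rw [h3]
        gcongr
    _ = √(δ n) * ((K + 1) / 2) := by
        nth_rewrite 2 [← hdd]
        field_simp

variable {X : ℕ → Ω → ℝ} {ι : Type*} [Fintype ι]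

theorem tendsto_mul_charFun_sub_one {Y : Ω → ℝ} (hY : AEMeasurable Y μ) (h0 : ∫ ω, Y ω ∂μ = 0)
    (h1 : ∫ ω, Y ω ^ 2 ∂μ = 1) (t : ℝ) :
    Tendsto (fun n : ℕ => (n : ℂ) * (charFun (μ.map Y) ((√(n : ℝ))⁻¹ * t) - 1)) atTop
      (𝓝 (-(t : ℂ) ^ 2 / 2)) := by
  have harg : Tendsto (fun n : ℕ => (√(n : ℝ))⁻¹ * t) atTop (𝓝 0) := by
    rw [← zero_mul t]
    exact (tendsto_inv_atTop_zero.comp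
      (Real.tendsto_sqrt_atTop.comp tendsto_natCast_atTop_atTop)).mul_const t
  have hT := (taylor_charFun_two hY h0 h1).comp_tendsto harg
  have hT2 : (fun n : ℕ => charFun (μ.map Y) ((√(n : ℝ))⁻¹ * t) -
      (1 - (((√(n : ℝ))⁻¹ * t : ℝ) : ℂ) ^ 2 / 2)) =o[atTop] fun n : ℕ => ((n : ℝ))⁻¹ := by
    refine Asymptotics.IsLittleO.of_const_mul_right (c := t ^ 2) ?_
    refine hT.congr_right fun n => ?_
    simp only [Function.comp_apply, mul_pow, inv_pow, Real.sq_sqrt (Nat.cast_nonneg n)]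
    ring
  have hT3 := hT2.tendsto_inv_smul_nhds_zero
  have := hT3.add_const (-(t : ℂ) ^ 2 / 2)
  rw [zero_add] at this
  refine this.congr' ?_
  filter_upwards [eventually_ge_atTop 1] with n hn
  have hn0 : (n : ℂ) ≠ 0 := by exact_mod_cast (by omega : n ≠ 0)
  have hsq : ((√(n : ℝ) : ℝ) : ℂ) ^ 2 = n := by
    exact_mod_cast congrArg Complex.ofReal (Real.sq_sqrt (Nat.cast_nonneg (α := ℝ) n))
  simp only [inv_inv, Complex.real_smul]
  push_cast
  rw [mul_pow, inv_pow, hsq]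
  field_simp
  ring

/-- The logarithm of the characteristic function of the limiting exceedance counts. -/
noncomputable def countExponent (τ : Finset ι → ℝ) (s : ι → ℝ) : ℂ := by
  classical exact ∑ J ∈ (Finset.univ : Finset (Finset ι)).erase ∅,
    (∏ j ∈ J, (Complex.exp (Complex.I * (s j : ℝ)) - 1)) * τ J

/-- Write the one-step characteristic function as `E[a w]`, with `a` from the sum and `w` from the
counts, and expand `a w - 1 = (a - 1) + (w - 1) + (a - 1)(w - 1)`. Multiplied by `n`, the first two
means converge to the two summands of the exponent and the third tends to `0`. -/
theorem tendsto_charFun_sumCountStep_pow (hm : Measurable (X 0)) (hmean : ∫ ω, X 0 ω ∂μ = 0)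
    (hvar : ∫ ω, X 0 ω ^ 2 ∂μ = 1) (hL2 : MemLp (X 0) 2 μ) {v : ℕ → ι → ℝ} {τ : Finset ι → ℝ}
    (hτ : ∀ J : Finset ι, J.Nonempty →
      Tendsto (fun n : ℕ => n * μ.real {ω | ∀ j ∈ J, v n j < X 0 ω}) atTop (𝓝 (τ J)))
    (t : WithLp 2 (ℝ × EuclideanSpace ℝ ι)) :
    Tendsto (fun n => charFun (μ.map fun ω => sumCountStep (v n) n (X 0 ω)) t ^ n) atTop
      (𝓝 (Complex.exp (-(t.fst : ℂ) ^ 2 / 2 + countExponent τ t.snd))) := by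
  classical
  set c : ι → ℂ := fun j => Complex.exp (Complex.I * (t.snd j : ℝ)) - 1 with hc
  set a : ℕ → Ω → ℂ := fun n ω => Complex.exp (Complex.I * ((√(n : ℝ))⁻¹ * t.fst * X 0 ω : ℝ))
    with ha
  set w : ℕ → Ω → ℂ := fun n ω =>
    ∏ j, (1 + c j * (Set.Ioi (v n j)).indicator (fun _ => (1 : ℂ)) (X 0 ω)) with hw
  set B : ℕ → Set Ω := fun n => {ω | ∃ j, v n j < X 0 ω} with hB
  have hBm : ∀ n, MeasurableSet (B n) := fun n => by
    have : B n = ⋃ j, {ω | v n j < X 0 ω} := by ext; simp [hB]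
    rw [this]
    exact MeasurableSet.iUnion fun j => measurableSet_lt measurable_const hm
  have ham : ∀ n, Measurable (a n) := fun n => by fun_prop
  have hwm : ∀ n, Measurable (w n) := fun n => by
    refine Finset.measurable_fun_prod _ fun j _ => measurable_const.add (measurable_const.mul ?_)
    exact (measurable_const.indicator measurableSet_Ioi).comp hm
  have hnorma : ∀ n ω, ‖a n ω‖ = 1 := fun n ω => by
    simp only [ha]
    rw [mul_comm, Complex.norm_exp_ofReal_mul_I]
  have hwB : ∀ n ω, ‖w n ω - 1‖ ≤ (B n).indicator (fun _ => (2 : ℝ)) ω := fun n ω =>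
    norm_prod_one_add_sub_one_le (v n) t.snd (X 0 ω)
  have hwle : ∀ n ω, ‖w n ω - 1‖ ≤ 2 := fun n ω => (hwB n ω).trans
    (Set.indicator_le_self' (fun _ _ => by norm_num) ω)
  have hai : ∀ n, Integrable (a n) μ := fun n =>
    Integrable.of_bound (ham n).aestronglyMeasurable 1
      (Eventually.of_forall fun ω => (hnorma n ω).le)
  have hwi : ∀ n, Integrable (fun ω => w n ω - 1) μ := fun n =>
    Integrable.of_bound ((hwm n).sub_const 1).aestronglyMeasurable 2
      (Eventually.of_forall fun ω => hwle n ω)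
  have hawi : ∀ n, Integrable (fun ω => (a n ω - 1) * (w n ω - 1)) μ := fun n => by
    refine Integrable.of_bound
      (((ham n).sub_const 1).mul ((hwm n).sub_const 1)).aestronglyMeasurable 4
      (Eventually.of_forall fun ω => ?_)
    rw [norm_mul]
    have h1 : ‖a n ω - 1‖ ≤ 2 := by
      refine (norm_sub_le _ _).trans ?_
      rw [hnorma, norm_one]; norm_num
    nlinarith [hwle n ω, norm_nonneg (a n ω - 1), norm_nonneg (w n ω - 1)]
  have hchar : ∀ n, charFun (μ.map fun ω => sumCountStep (v n) n (X 0 ω)) t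
      = ∫ ω, a n ω * w n ω ∂μ := fun n => by
    have hstep : Measurable fun ω => sumCountStep (v n) n (X 0 ω) :=
      (measurable_sumCountStep (v n) n).comp hm
    rw [charFun_apply, integral_map hstep.aemeasurable (by fun_prop)]
    exact integral_congr_ae (Eventually.of_forall fun ω => exp_inner_sumCountStep (v n) n _ t)
  have hchara : ∀ n : ℕ, charFun (μ.map (X 0)) ((√(n : ℝ))⁻¹ * t.fst) = ∫ ω, a n ω ∂μ :=
    fun n => by
      rw [charFun_apply_real, integral_map hm.aemeasurable (by fun_prop)]
      refine integral_congr_ae (Eventually.of_forall fun ω => ?_)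
      simp only [ha]
      congr 1
      push_cast
      ring
  have hdecomp : ∀ n, ∫ ω, a n ω * w n ω ∂μ = 1 + ((charFun (μ.map (X 0)) ((√(n : ℝ))⁻¹ * t.fst) - 1)
      + ∫ ω, (w n ω - 1) ∂μ + ∫ ω, (a n ω - 1) * (w n ω - 1) ∂μ) := fun n => by
    have : ∀ ω, a n ω * w n ω = a n ω + (w n ω - 1) + (a n ω - 1) * (w n ω - 1) := fun ω => by ring
    simp_rw [this]
    rw [integral_add (f := fun ω => a n ω + (w n ω - 1)) ((hai n).add (hwi n)) (hawi n),
      integral_add (hai n) (hwi n), hchara]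
    ring
  have hlim1 := tendsto_mul_charFun_sub_one hm.aemeasurable hmean hvar t.fst
  have hlim2 : Tendsto (fun n : ℕ => (n : ℂ) * ∫ ω, (w n ω - 1) ∂μ) atTop
      (𝓝 (countExponent τ t.snd)) := by
    have hval : ∀ n : ℕ, (n : ℂ) * ∫ ω, (w n ω - 1) ∂μ
        = ∑ J ∈ (Finset.univ : Finset (Finset ι)).erase ∅, (∏ j ∈ J, c j) *
          ((n * μ.real {ω | ∀ j ∈ J, v n j < X 0 ω} : ℝ) : ℂ) := fun n => by
      have hJm : ∀ J : Finset ι, MeasurableSet {ω | ∀ j ∈ J, v n j < X 0 ω} := fun J => by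
        have : {ω | ∀ j ∈ J, v n j < X 0 ω} = ⋂ j ∈ J, {ω | v n j < X 0 ω} := by ext; simp
        rw [this]
        exact J.measurableSet_biInter fun j _ => measurableSet_lt measurable_const hm
      have hpt : ∀ ω, w n ω - 1 = ∑ J ∈ (Finset.univ : Finset (Finset ι)).erase ∅,
          (∏ j ∈ J, c j) * {ω | ∀ j ∈ J, v n j < X 0 ω}.indicator (fun _ => (1 : ℂ)) ω :=
        fun ω => prod_one_add_indicator_sub_one (v n) c (X 0 ω)
      simp_rw [hpt]
      rw [integral_finsetSum _ fun J _ =>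
        ((integrable_const (1 : ℂ)).indicator (hJm J)).const_mul _, Finset.mul_sum]
      refine Finset.sum_congr rfl fun J _ => ?_
      rw [integral_const_mul, integral_indicator_const _ (hJm J)]
      push_cast
      simp
      ring
    simp_rw [hval]
    unfold countExponent
    refine tendsto_finsetSum _ fun J hJ => Tendsto.const_mul _ ?_
    exact (Complex.continuous_ofReal.tendsto _).comp
      (hτ J (Finset.nonempty_iff_ne_empty.2 (Finset.ne_of_mem_erase hJ)))
  -- Here `|a - 1| ≤ |t X| / √n`, while `w - 1` is supported on `B n` with `n μ(B n)` bounded, so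
  -- the term is controlled by `√n` times the integral of `|X|` over `B n`.
  have hlim3 : Tendsto (fun n : ℕ => (n : ℂ) * ∫ ω, (a n ω - 1) * (w n ω - 1) ∂μ) atTop (𝓝 0) := by
    set K : ℝ := (∑ j, τ {j}) + 1 with hK
    have hBK : ∀ᶠ n : ℕ in atTop, n * μ.real (B n) ≤ K := by
      have hs : Tendsto (fun n : ℕ => ∑ j, n * μ.real {ω | v n j < X 0 ω}) atTop
          (𝓝 (∑ j, τ {j})) := by
        refine tendsto_finsetSum _ fun j _ => ?_
        simpa using hτ {j} (Finset.singleton_nonempty j)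
      filter_upwards [hs.eventually_le_const (lt_add_one _)] with n hn
      refine le_trans ?_ hn
      rw [← Finset.mul_sum]
      gcongr
      have : B n = ⋃ j, {ω | v n j < X 0 ω} := by ext; simp [hB]
      rw [this]
      exact measureReal_iUnion_fintype_le _
    have hsm := (tendsto_sqrt_mul_setIntegral_abs hL2 hBK).const_mul (2 * |t.fst|)
    rw [mul_zero] at hsm
    refine squeeze_zero_norm (fun n => ?_) hsm
    have hbound : ‖∫ ω, (a n ω - 1) * (w n ω - 1) ∂μ‖
        ≤ ∫ ω in B n, (√(n : ℝ))⁻¹ * |t.fst| * 2 * |X 0 ω| ∂μ := by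
      rw [← integral_indicator (hBm n)]
      refine (norm_integral_le_integral_norm _).trans (integral_mono_of_nonneg
        (Eventually.of_forall fun ω => norm_nonneg _)
        (((hL2.integrable one_le_two).abs.const_mul _).indicator (hBm n))
        (Eventually.of_forall fun ω => ?_))
      simp only [norm_mul]
      have h1 : ‖a n ω - 1‖ ≤ (√(n : ℝ))⁻¹ * |t.fst| * |X 0 ω| := by
        refine Real.norm_exp_I_mul_ofReal_sub_one_le.trans_eq ?_
        rw [Real.norm_eq_abs, abs_mul, abs_mul, abs_of_nonneg (inv_nonneg.2 (Real.sqrt_nonneg _))]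
      have h2 := hwB n ω
      by_cases hω : ω ∈ B n
      · rw [Set.indicator_of_mem hω] at h2 ⊢
        calc ‖a n ω - 1‖ * ‖w n ω - 1‖ ≤ ((√(n : ℝ))⁻¹ * |t.fst| * |X 0 ω|) * 2 := by gcongr
          _ = _ := by ring
      · rw [Set.indicator_of_notMem hω] at h2 ⊢
        rw [le_antisymm h2 (norm_nonneg _), mul_zero]
    rw [norm_mul, Complex.norm_natCast]
    calc n * ‖∫ ω, (a n ω - 1) * (w n ω - 1) ∂μ‖
        ≤ n * ∫ ω in B n, (√(n : ℝ))⁻¹ * |t.fst| * 2 * |X 0 ω| ∂μ := by gcongr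
      _ = (n * (√(n : ℝ))⁻¹) * (2 * |t.fst|) * ∫ ω in B n, |X 0 ω| ∂μ := by
          rw [integral_const_mul]; ring
      _ = 2 * |t.fst| * (√(n : ℝ) * ∫ ω in B n, |X 0 ω| ∂μ) := by
          rw [← div_eq_mul_inv, Real.div_sqrt]; ring
  have hsum := (hlim1.add hlim2).add hlim3
  rw [add_zero] at hsum
  simp_rw [hchar, hdecomp]
  refine Complex.tendsto_one_add_pow_exp_of_tendsto (hsum.congr fun n => ?_)
  ring

/-- Joint weak convergence of normalised sums and exceedance counts, with independent limits. -/
theorem exists_joint_limit (hmeas : ∀ i, Measurable (X i)) (hindep : iIndepFun X μ)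
    (hident : ∀ i, IdentDistrib (X i) (X 0) μ μ) (hmean : ∫ ω, X 0 ω ∂μ = 0)
    (hvar : ∫ ω, X 0 ω ^ 2 ∂μ = 1) (hL2 : MemLp (X 0) 2 μ) {v : ℕ → ι → ℝ} {τ : Finset ι → ℝ}
    (hτ : ∀ J : Finset ι, J.Nonempty →
      Tendsto (fun n : ℕ => n * μ.real {ω | ∀ j ∈ J, v n j < X 0 ω}) atTop (𝓝 (τ J))) :
    ∃ κ : ProbabilityMeasure (EuclideanSpace ℝ ι),
      (∀ s, charFun (κ : Measure (EuclideanSpace ℝ ι)) s = Complex.exp (countExponent τ s)) ∧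
      ∀ (f : BoundedContinuousFunction ℝ ℝ)
        (g : BoundedContinuousFunction (EuclideanSpace ℝ ι) ℝ),
        Tendsto (fun n => ∫ ω, f (partialSum X n ω / √(n : ℝ)) *
            g (WithLp.toLp 2 fun j => (exceedCount X (Finset.range n) (v n j) ω : ℝ)) ∂μ) atTop
          (𝓝 ((∫ x, f x ∂gaussianReal 0 1) * ∫ z, g z ∂(κ : Measure (EuclideanSpace ℝ ι)))) := by
  have hVm : ∀ n, Measurable (sumCountVector X (v n) n) := fun n =>
    measurable_sumCountVector hmeas (v n) n
  let P : ℕ → ProbabilityMeasure (WithLp 2 (ℝ × EuclideanSpace ℝ ι)) := fun n =>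
    ⟨μ.map (sumCountVector X (v n) n), Measure.isProbabilityMeasure_map (hVm n).aemeasurable⟩
  have hcont : Continuous fun t : WithLp 2 (ℝ × EuclideanSpace ℝ ι) =>
      Complex.exp (-(t.fst : ℂ) ^ 2 / 2 + countExponent τ t.snd) := by
    unfold countExponent WithLp.fst WithLp.snd
    fun_prop
  obtain ⟨ρ, hρ, hPρ⟩ := exists_tendsto_of_tendsto_charFun (μ := P) hcont.continuousAt fun t => by
    refine (tendsto_charFun_sumCountStep_pow (hmeas 0) hmean hvar hL2 hτ t).congr fun n => ?_
    exact (charFun_sumCountVector hmeas hindep hident (v n) n t).symm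
  have hsnd : Measurable fun z : WithLp 2 (ℝ × EuclideanSpace ℝ ι) => z.snd := by
    unfold WithLp.snd; fun_prop
  let κ : ProbabilityMeasure (EuclideanSpace ℝ ι) := ρ.map hsnd.aemeasurable
  have hκ : ∀ s, charFun (κ : Measure (EuclideanSpace ℝ ι)) s = Complex.exp (countExponent τ s) := by
    intro s
    have h := hρ (WithLp.toLp 2 (0, s))
    rw [charFun_apply] at h
    simp only [κ, ProbabilityMeasure.toMeasure_map]
    rw [charFun_apply, integral_map hsnd.aemeasurable (by fun_prop)]
    simpa [WithLp.prod_inner_apply] using h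
  -- The limiting characteristic function factorises, which forces the limit law to be a product.
  have hprod : (ρ : Measure (WithLp 2 (ℝ × EuclideanSpace ℝ ι)))
      = ((gaussianReal 0 1).prod (κ : Measure (EuclideanSpace ℝ ι))).map (WithLp.toLp 2) := by
    have : IsProbabilityMeasure
        (((gaussianReal 0 1).prod (κ : Measure (EuclideanSpace ℝ ι))).map (WithLp.toLp 2)) :=
      Measure.isProbabilityMeasure_map (by fun_prop)
    refine Measure.ext_of_charFun (funext fun t => ?_)
    rw [hρ, charFun_prod, hκ, charFun_gaussianReal, ← Complex.exp_add]
    congr 1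
    simp
    ring
  refine ⟨κ, hκ, fun f g => ?_⟩
  rw [ProbabilityMeasure.tendsto_iff_forall_integral_tendsto] at hPρ
  let F : BoundedContinuousFunction (WithLp 2 (ℝ × EuclideanSpace ℝ ι)) ℝ :=
    f.compContinuous ⟨fun z => (WithLp.ofLp z).1, by fun_prop⟩ *
      g.compContinuous ⟨fun z => (WithLp.ofLp z).2, by fun_prop⟩
  have hF : ∀ z, F z = f (WithLp.ofLp z).1 * g (WithLp.ofLp z).2 := fun z => rfl
  have key := hPρ F
  rw [hprod, integral_map (by fun_prop) F.continuous.aestronglyMeasurable] at key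
  simp only [hF] at key
  rw [integral_prod_mul (fun x => f x) (fun z => g z)] at key
  refine key.congr fun n => ?_
  simp only [P, ProbabilityMeasure.coe_mk]
  rw [integral_map (hVm n).aemeasurable
    (by simp_rw [← hF]; exact F.continuous.aestronglyMeasurable)]
  rfl

end JointLimit

/-! ### Lipschitz approximation of half-line indicators -/

section Ramp

/-- The piecewise linear function equal to `1` on `(-∞, c]` and to `0` on `[c + δ, ∞)`. -/
noncomputable def ramp (c δ x : ℝ) : ℝ := max 0 (min 1 ((c + δ - x) / δ))

theorem ramp_mem_Icc (c δ x : ℝ) : ramp c δ x ∈ Set.Icc (0 : ℝ) 1 :=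
  ⟨le_max_left _ _, max_le zero_le_one (min_le_left _ _)⟩

theorem ramp_eq_one {c δ x : ℝ} (hδ : 0 < δ) (hx : x ≤ c) : ramp c δ x = 1 := by
  have : 1 ≤ (c + δ - x) / δ := by rw [le_div_iff₀ hδ]; linarith
  rw [ramp, min_eq_left this, max_eq_right zero_le_one]

theorem ramp_eq_zero {c δ x : ℝ} (hδ : 0 < δ) (hx : c + δ ≤ x) : ramp c δ x = 0 := by
  have : (c + δ - x) / δ ≤ 0 := div_nonpos_of_nonpos_of_nonneg (by linarith) hδ.le
  rw [ramp, max_eq_left ((min_le_right _ _).trans this)]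

theorem continuous_ramp (c δ : ℝ) : Continuous (ramp c δ) := by
  unfold ramp
  fun_prop

theorem abs_ramp_sub_le {c δ : ℝ} (hδ : 0 < δ) (x y : ℝ) :
    |ramp c δ x - ramp c δ y| ≤ 1 / δ * |x - y| := by
  unfold ramp
  calc |max 0 (min 1 ((c + δ - x) / δ)) - max 0 (min 1 ((c + δ - y) / δ))|
      ≤ |min 1 ((c + δ - x) / δ) - min 1 ((c + δ - y) / δ)| := by
        simpa using abs_max_sub_max_le_max 0 (min 1 ((c + δ - x) / δ)) 0 (min 1 ((c + δ - y) / δ))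
    _ ≤ |(c + δ - x) / δ - (c + δ - y) / δ| := by
        simpa using abs_min_sub_min_le_max 1 ((c + δ - x) / δ) 1 ((c + δ - y) / δ)
    _ = 1 / δ * |x - y| := by
        rw [← sub_div, abs_div, abs_of_pos hδ, abs_sub_comm x y,
          show c + δ - x - (c + δ - y) = y - x by ring]
        ring

/-- `ramp` as a bounded continuous function. -/
noncomputable def rampBCF (c δ : ℝ) : BoundedContinuousFunction ℝ ℝ :=
  BoundedContinuousFunction.ofNormedAddCommGroup (ramp c δ) (continuous_ramp c δ) 1 fun x => by
    rw [Real.norm_of_nonneg (ramp_mem_Icc c δ x).1]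
    exact (ramp_mem_Icc c δ x).2

theorem integral_ramp_bounds {γ : Measure ℝ} [IsProbabilityMeasure γ] (c : ℝ) {δ : ℝ}
    (hδ : 0 < δ) : cdf γ c ≤ ∫ x, ramp c δ x ∂γ ∧ ∫ x, ramp c δ x ∂γ ≤ cdf γ (c + δ) := by
  have hint : Integrable (ramp c δ) γ := (rampBCF c δ).integrable γ
  have hind : ∀ a : ℝ, Integrable ((Set.Iic a).indicator (fun _ => (1 : ℝ))) γ := fun a =>
    (integrable_const (1 : ℝ)).indicator measurableSet_Iic
  rw [cdf_eq_real, cdf_eq_real, ← integral_indicator_one measurableSet_Iic,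
    ← integral_indicator_one measurableSet_Iic]
  constructor
  · refine integral_mono (hind c) hint fun x => ?_
    by_cases hx : x ≤ c
    · rw [ramp_eq_one hδ hx, Set.indicator_of_mem (by exact hx)]; rfl
    · rw [Set.indicator_of_notMem (by exact hx)]
      exact (ramp_mem_Icc c δ x).1
  · refine integral_mono hint (hind (c + δ)) fun x => ?_
    by_cases hx : x ≤ c + δ
    · rw [Set.indicator_of_mem (by exact hx)]
      exact (ramp_mem_Icc c δ x).2
    · rw [ramp_eq_zero hδ (not_le.1 hx).le, Set.indicator_of_notMem (by exact hx)]

theorem continuous_stdNormalCDF : Continuous stdNormalCDF := by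
  rw [continuous_iff_continuousAt]
  intro y
  have : NullSingletonClass (gaussianReal 0 1) := nullSingletonClass_gaussianReal one_ne_zero
  have hs : (cdf (gaussianReal 0 1)).measure {y} = 0 := by
    rw [measure_cdf]
    exact measure_singleton y
  rw [StieltjesFunction.measure_singleton, ENNReal.ofReal_eq_zero] at hs
  have hmono := (cdf (gaussianReal 0 1)).mono
  refine hmono.continuousAt_iff_leftLim_eq_rightLim.2 ?_
  rw [StieltjesFunction.rightLim_eq]
  exact le_antisymm (hmono.leftLim_le le_rfl) (by linarith)

end Ramp

/-! ### Continuous test functions for integer counts -/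

section OrthantRamp

variable {ι : Type*} [Fintype ι]

/-- A bounded continuous function on `ℝ^ι` which, on integer vectors, is the indicator of
`{z | ∀ j, z j ≤ r j}`. -/
noncomputable def orthantRamp (r : ι → ℕ) : BoundedContinuousFunction (EuclideanSpace ℝ ι) ℝ :=
  BoundedContinuousFunction.ofNormedAddCommGroup (fun z => ∏ j, ramp (r j) 1 (z j))
    (continuous_finsetProd _ fun j _ => (continuous_ramp _ _).comp (by fun_prop)) 1 fun z => by
      rw [Real.norm_of_nonneg (Finset.prod_nonneg fun j _ => (ramp_mem_Icc _ _ _).1)]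
      exact Finset.prod_le_one (fun j _ => (ramp_mem_Icc _ _ _).1) fun j _ => (ramp_mem_Icc _ _ _).2

theorem ramp_natCast (r m : ℕ) : ramp r 1 m = if m ≤ r then 1 else 0 := by
  split_ifs with h
  · exact ramp_eq_one one_pos (by exact_mod_cast h)
  · exact ramp_eq_zero one_pos (by exact_mod_cast (by omega : r + 1 ≤ m))

theorem orthantRamp_exceedCount {Ω : Type*} {X : ℕ → Ω → ℝ} (v : ι → ℝ) (r : ι → ℕ) (s : Finset ℕ) (ω : Ω) :
    orthantRamp r (WithLp.toLp 2 fun j => (exceedCount X s (v j) ω : ℝ))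
      = (fewExceed X v r s).indicator (fun _ => 1) ω := by
  change ∏ j, ramp (r j) 1 (exceedCount X s (v j) ω : ℝ) = _
  simp_rw [ramp_natCast]
  by_cases hω : ω ∈ fewExceed X v r s
  · rw [Set.indicator_of_mem hω]
    exact Finset.prod_eq_one fun j _ => if_pos (hω j)
  · rw [Set.indicator_of_notMem hω]
    simp only [fewExceed, Set.mem_ofPred_eq, not_forall] at hω
    obtain ⟨j, hj⟩ := hω
    exact Finset.prod_eq_zero (Finset.mem_univ j) (if_neg hj)

end OrthantRamp

/-! ### Almost sure limits from asymptotic independence -/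

section LogAverage

variable {Ω : Type*} [MeasurableSpace Ω] {μ : Measure Ω} [IsProbabilityMeasure μ]
  {X : ℕ → Ω → ℝ} {ι : Type*} [Fintype ι]

/-- The events `fewExceed X (v n) r (range n)` have limiting probability `h` and are asymptotically
independent of the normalised partial sums. -/
def AsympIndepSum (μ : Measure Ω) (X : ℕ → Ω → ℝ) (v : ℕ → ι → ℝ) (r : ι → ℕ) (h : ℝ) : Prop :=
  Tendsto (fun n => μ.real (fewExceed X (v n) r (Finset.range n))) atTop (𝓝 h) ∧
    ∀ f : BoundedContinuousFunction ℝ ℝ,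
      Tendsto (fun n => ∫ ω, (fewExceed X (v n) r (Finset.range n)).indicator (fun _ => 1) ω *
        f (partialSum X n ω / √(n : ℝ)) ∂μ) atTop (𝓝 (h * ∫ x, f x ∂gaussianReal 0 1))

theorem ae_tendsto_logAverage_fewExceed (hmeas : ∀ i, Measurable (X i)) (hindep : iIndepFun X μ)
    (hident : ∀ i, IdentDistrib (X i) (X 0) μ μ) (hmean : ∫ ω, X 0 ω ∂μ = 0)
    (hvar : ∫ ω, X 0 ω ^ 2 ∂μ = 1) (hL2 : ∀ i, MemLp (X i) 2 μ) {v : ℕ → ι → ℝ} {r : ι → ℕ} {h : ℝ}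
    (hA : AsympIndepSum μ X v r h) (y : ℝ) :
    ∀ᵐ ω ∂μ, Tendsto (fun N => logAverage (fun n => {ω' | ω' ∈ fewExceed X (v n) r (Finset.range n) ∧
      partialSum X n ω' / √(n : ℝ) ≤ y}) N ω) atTop (𝓝 (h * stdNormalCDF y)) := by
  have hh0 : 0 ≤ h := ge_of_tendsto' hA.1 fun n => measureReal_nonneg
  have hSm : ∀ n, Measurable (partialSum X n) := fun n =>
    Finset.measurable_fun_sum _ fun i _ => hmeas i
  have hsmooth : ∀ c δ : ℝ, 0 < δ → ∀ᵐ ω ∂μ, Tendsto (fun N : ℕ => (1 / Real.log N) *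
      ∑ n ∈ Finset.Icc 1 N, 1 / (n : ℝ) *
        ((fewExceed X (v n) r (Finset.range n)).indicator (fun _ => 1) ω *
          ramp c δ (partialSum X n ω / √(n : ℝ)))) atTop
        (𝓝 (h * ∫ x, ramp c δ x ∂gaussianReal 0 1)) := by
    intro c δ hδ
    have h01 : ∀ n ω, (fewExceed X (v n) r (Finset.range n)).indicator (fun _ => (1 : ℝ)) ω *
        ramp c δ (partialSum X n ω / √(n : ℝ)) ∈ Set.Icc (0 : ℝ) 1 := fun n ω => by
      by_cases hω : ω ∈ fewExceed X (v n) r (Finset.range n)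
      · simpa [hω] using ramp_mem_Icc c δ (partialSum X n ω / √(n : ℝ))
      · simp [hω]
    refine ae_tendsto_logarithmic_mean (fun n => ?_) (fun n ω => (h01 n ω).1)
      (fun n ω => (h01 n ω).2) (fun m n hm hmn => abs_covariance_fewExceed_le hmeas hindep hident
        hmean hvar hL2 v r (ramp_mem_Icc c δ) (by positivity) (abs_ramp_sub_le hδ)
        (continuous_ramp c δ).measurable hm hmn) (hA.2 (rampBCF c δ))
    exact (measurable_const.indicator (measurableSet_fewExceed hmeas _ _ _)).mul
      ((continuous_ramp c δ).measurable.comp ((hSm n).div_const _))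
  have hδpos : ∀ m : ℕ, (0 : ℝ) < 1 / ((m : ℝ) + 1) := fun m => by positivity
  -- The covariance bound requires a Lipschitz function, so the indicator is sandwiched between
  -- ramps starting at `y - δ` and at `y`. Taking `δ = 1 / (m + 1)` leaves a single null set.
  have hall : ∀ᵐ ω ∂μ, ∀ m : ℕ, _ := ae_all_iff.2 fun m : ℕ => (hsmooth y _ (hδpos m)).and
    (hsmooth (y - 1 / ((m : ℝ) + 1)) _ (hδpos m))
  filter_upwards [hall] with ω hω
  have hδlim : Tendsto (fun m : ℕ => 1 / ((m : ℝ) + 1)) atTop (𝓝 0) :=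
    tendsto_one_div_add_atTop_nhds_zero_nat
  have hup : Tendsto (fun m : ℕ => h * stdNormalCDF (y + 1 / ((m : ℝ) + 1))) atTop
      (𝓝 (h * stdNormalCDF y)) := by
    have := (continuous_stdNormalCDF.tendsto (y + 0)).comp (hδlim.const_add y)
    rw [add_zero] at this
    exact this.const_mul h
  have hdown : Tendsto (fun m : ℕ => h * stdNormalCDF (y - 1 / ((m : ℝ) + 1))) atTop
      (𝓝 (h * stdNormalCDF y)) := by
    have := (continuous_stdNormalCDF.tendsto (y - 0)).comp (hδlim.const_sub y)
    rw [sub_zero] at this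
    exact this.const_mul h
  refine tendsto_order.2 ⟨fun a ha => ?_, fun a ha => ?_⟩
  · obtain ⟨m, hm⟩ := (hdown.eventually_const_lt ha).exists
    have hb := (integral_ramp_bounds (γ := gaussianReal 0 1) (y - 1 / ((m : ℝ) + 1)) (hδpos m)).1
    have ha' := hm.trans_le (mul_le_mul_of_nonneg_left hb hh0)
    filter_upwards [(hω m).2.eventually_const_lt ha'] with N hN
    refine hN.trans_le ?_
    unfold logAverage
    gcongr with n hn
    by_cases hAn : ω ∈ fewExceed X (v n) r (Finset.range n)
    · by_cases hS : partialSum X n ω / √(n : ℝ) ≤ y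
      · simpa [hAn, hS] using (ramp_mem_Icc _ _ _).2
      · rw [ramp_eq_zero (hδpos m) (by linarith), mul_zero]
        exact Set.indicator_nonneg (fun _ _ => zero_le_one) _
    · simp [hAn]
  · obtain ⟨m, hm⟩ := (hup.eventually_lt_const ha).exists
    have hb := (integral_ramp_bounds (γ := gaussianReal 0 1) y (hδpos m)).2
    have ha' := (mul_le_mul_of_nonneg_left hb hh0).trans_lt hm
    filter_upwards [(hω m).1.eventually_lt_const ha'] with N hN
    refine lt_of_le_of_lt ?_ hN
    unfold logAverage
    gcongr with n hn
    by_cases hAn : ω ∈ fewExceed X (v n) r (Finset.range n)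
    · by_cases hS : partialSum X n ω / √(n : ℝ) ≤ y
      · rw [ramp_eq_one (hδpos m) hS]
        simp [hAn, hS]
      · simpa [hAn, hS] using (ramp_mem_Icc _ _ _).1
    · simp [hAn]

/-- Counts are integers, so the indicator of `fewExceed` is itself a continuous function of them and
weak convergence applies without any continuity-set condition. -/
theorem exists_asympIndepSum_of_tendsto (hmeas : ∀ i, Measurable (X i)) (hindep : iIndepFun X μ)
    (hident : ∀ i, IdentDistrib (X i) (X 0) μ μ) (hmean : ∫ ω, X 0 ω ∂μ = 0)
    (hvar : ∫ ω, X 0 ω ^ 2 ∂μ = 1) (hL2 : MemLp (X 0) 2 μ) {v : ℕ → ι → ℝ} {τ : Finset ι → ℝ}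
    (hτ : ∀ J : Finset ι, J.Nonempty →
      Tendsto (fun n : ℕ => n * μ.real {ω | ∀ j ∈ J, v n j < X 0 ω}) atTop (𝓝 (τ J))) :
    ∃ κ : ProbabilityMeasure (EuclideanSpace ℝ ι),
      (∀ s, charFun (κ : Measure (EuclideanSpace ℝ ι)) s = Complex.exp (countExponent τ s)) ∧
      ∀ r : ι → ℕ, AsympIndepSum μ X v r
        (∫ z, orthantRamp r z ∂(κ : Measure (EuclideanSpace ℝ ι))) := by
  obtain ⟨κ, hκ, hlim⟩ := exists_joint_limit hmeas hindep hident hmean hvar hL2 hτ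
  refine ⟨κ, hκ, fun r => ⟨?_, fun f => ?_⟩⟩
  · have h := hlim (BoundedContinuousFunction.const ℝ 1) (orthantRamp r)
    simp only [orthantRamp_exceedCount, BoundedContinuousFunction.const_apply, one_mul,
      integral_const, probReal_univ, smul_eq_mul] at h
    refine h.congr fun n => ?_
    rw [← integral_indicator_one (measurableSet_fewExceed hmeas _ _ _)]
    rfl
  · have h := hlim f (orthantRamp r)
    simp only [orthantRamp_exceedCount] at h
    rw [mul_comm]
    refine h.congr fun n => ?_
    simp_rw [mul_comm]

theorem asympIndepSum_zero {v : ℕ → ι → ℝ} {r : ι → ℕ} (hmeas : ∀ i, Measurable (X i))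
    (h0 : Tendsto (fun n => μ.real (fewExceed X (v n) r (Finset.range n))) atTop (𝓝 0)) :
    AsympIndepSum μ X v r 0 := by
  refine ⟨h0, fun f => ?_⟩
  rw [zero_mul]
  have hlim := h0.mul_const ‖f‖
  rw [zero_mul] at hlim
  refine squeeze_zero_norm (fun n => ?_) hlim
  have hm := measurableSet_fewExceed (X := X) hmeas (v n) r (Finset.range n)
  rw [← integral_indicator_one hm, ← integral_mul_const]
  refine (norm_integral_le_integral_norm _).trans (integral_mono_of_nonneg
    (Eventually.of_forall fun ω => norm_nonneg _)
    (((integrable_const (1 : ℝ)).indicator hm).mul_const _) (Eventually.of_forall fun ω => ?_))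
  simp only [norm_mul]
  by_cases hω : ω ∈ fewExceed X (v n) r (Finset.range n)
  · simpa [hω] using f.norm_coe_le_norm _
  · simp [hω]

end LogAverage

/-! ### From powers `(1 - p n) ^ n` to rates `n * p n` -/

section Tails

/-- Taking logarithms, `n log (1 - p) → log g`, so `p → 0`; then `p` is squeezed between `-(1 - p)
log (1 - p)` and `-log (1 - p)`. -/
theorem tendsto_mul_of_tendsto_one_sub_pow {p : ℕ → ℝ} (hp1 : ∀ n, p n ≤ 1)
    {g : ℝ} (hg : 0 < g) (h : Tendsto (fun n => (1 - p n) ^ n) atTop (𝓝 g)) :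
    Tendsto (fun n : ℕ => n * p n) atTop (𝓝 (-Real.log g)) := by
  have hpos : ∀ᶠ n in atTop, 0 < 1 - p n := by
    filter_upwards [h.eventually_const_lt hg, eventually_ge_atTop 1] with n hn hn1
    refine lt_of_le_of_ne (by linarith [hp1 n]) fun h0 => ?_
    rw [← h0, zero_pow (by omega)] at hn
    exact lt_irrefl _ hn
  have hlog : Tendsto (fun n : ℕ => n * Real.log (1 - p n)) atTop (𝓝 (Real.log g)) :=
    (h.log hg.ne').congr fun n => Real.log_pow _ _
  have hlog0 : Tendsto (fun n : ℕ => Real.log (1 - p n)) atTop (𝓝 0) := by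
    have := hlog.mul (tendsto_inv_atTop_nhds_zero_nat (𝕜 := ℝ))
    rw [mul_zero] at this
    refine this.congr' ?_
    filter_upwards [eventually_ge_atTop 1] with n hn
    have : (n : ℝ) ≠ 0 := by positivity
    field_simp
  have hone : Tendsto (fun n => 1 - p n) atTop (𝓝 1) := by
    have := (Real.continuous_exp.tendsto 0).comp hlog0
    rw [Real.exp_zero] at this
    refine this.congr' ?_
    filter_upwards [hpos] with n hn
    exact Real.exp_log hn
  have hlow := hlog.neg.mul hone
  rw [mul_one] at hlow
  refine tendsto_of_tendsto_of_tendsto_of_le_of_le' hlow hlog.neg ?_ ?_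
  · filter_upwards [hpos] with n hn
    have h1 := Real.one_sub_inv_le_log_of_pos hn
    have h2 : -Real.log (1 - p n) * (1 - p n) ≤ p n := by
      have : (1 - (1 - p n)⁻¹) * (1 - p n) = -p n := by field_simp; ring
      nlinarith
    have hn0 : (0 : ℝ) ≤ n := Nat.cast_nonneg n
    nlinarith
  · filter_upwards [hpos] with n hn
    have h1 := Real.log_le_sub_one_of_pos hn
    have hn0 : (0 : ℝ) ≤ n := Nat.cast_nonneg n
    nlinarith

theorem tendsto_mul_atTop_of_tendsto_one_sub_pow {p : ℕ → ℝ} (hp0 : ∀ n, 0 ≤ p n)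
    (h : Tendsto (fun n => (1 - p n) ^ n) atTop (𝓝 0)) :
    Tendsto (fun n : ℕ => n * p n) atTop atTop := by
  refine tendsto_atTop.2 fun b => ?_
  have hN : ∀ᶠ n : ℕ in atTop, 2 * b ≤ n := tendsto_natCast_atTop_atTop.eventually_ge_atTop (2 * b)
  filter_upwards [h.eventually_lt_const (Real.exp_pos (-(2 * b))), hN] with n hn hnb
  have hn0 : (0 : ℝ) ≤ n := Nat.cast_nonneg n
  -- For `p ≤ 1 / 2` one has `log (1 - p) ≥ -2 p`, which explains the factor `2` in the threshold
  -- `exp (-2 b)`.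
  rcases le_total (1 / 2) (p n) with hp | hp
  · nlinarith
  · have hpos : 0 < 1 - p n := by linarith
    by_contra hlt
    push Not at hlt
    have h2 : (1 - p n) ^ n = Real.exp (n * Real.log (1 - p n)) := by
      rw [Real.exp_nat_mul, Real.exp_log hpos]
    rw [h2, Real.exp_lt_exp] at hn
    have h1 := Real.one_sub_inv_le_log_of_pos hpos
    have h3 : (n : ℝ) * (1 - (1 - p n)⁻¹) ≤ n * Real.log (1 - p n) := by gcongr
    have h5 : -(2 * p n) ≤ 1 - (1 - p n)⁻¹ := by
      have : (1 - p n)⁻¹ ≤ 1 + 2 * p n := by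
        rw [inv_le_iff_one_le_mul₀ hpos]
        nlinarith [hp0 n]
      linarith
    nlinarith

end Tails

/-! ### The limiting distribution function of one order statistic -/

section OrderCDF

/-- The limiting probability that at most `r` variables exceed a level whose probability of not
being exceeded tends to `g`. -/
noncomputable def orderCDF (r : ℕ) (g : ℝ) : ℝ :=
  g * ∑ i ∈ Finset.range (r + 1), (-Real.log g) ^ i / (i.factorial : ℝ)

theorem orderCDF_zero (r : ℕ) : orderCDF r 0 = 0 := by simp [orderCDF]

theorem orderCDF_one (r : ℕ) : orderCDF r 1 = 1 := by
  simp [orderCDF, Finset.sum_range_succ']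

theorem tendsto_mul_log_pow_nhdsGT_zero (i : ℕ) :
    Tendsto (fun x : ℝ => x * Real.log x ^ i) (𝓝[>] 0) (𝓝 0) := by
  rcases Nat.eq_zero_or_pos i with rfl | hi
  · simp only [pow_zero, mul_one]
    exact tendsto_id.mono_left nhdsWithin_le_nhds
  · have h := (tendsto_log_mul_rpow_nhdsGT_zero
      (r := ((i : ℝ)⁻¹)) (by positivity)).pow i
    rw [zero_pow hi.ne'] at h
    refine h.congr' ?_
    filter_upwards [self_mem_nhdsWithin] with x hx
    rw [mul_pow, Real.rpow_inv_natCast_pow (le_of_lt hx) hi.ne', mul_comm]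

/-- Continuity must include the endpoint `0`, for the left tail of the limiting marginals. There `g
(log g) ^ i → 0` matches the value `0`. -/
theorem continuousOn_orderCDF (r : ℕ) : ContinuousOn (orderCDF r) (Set.Ici 0) := by
  intro x hx
  rcases eq_or_lt_of_le (show (0 : ℝ) ≤ x from hx) with rfl | hpos
  · rw [← continuousWithinAt_Ioi_iff_Ici, ContinuousWithinAt, orderCDF_zero]
    have h : Tendsto (fun g : ℝ => ∑ i ∈ Finset.range (r + 1),
        (-1) ^ i / (i.factorial : ℝ) * (g * Real.log g ^ i)) (𝓝[>] 0) (𝓝 0) := by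
      have := tendsto_finsetSum (Finset.range (r + 1)) fun i _ =>
        (tendsto_mul_log_pow_nhdsGT_zero i).const_mul ((-1) ^ i / (i.factorial : ℝ))
      simpa using this
    refine h.congr fun g => ?_
    rw [orderCDF, Finset.mul_sum]
    refine Finset.sum_congr rfl fun i _ => ?_
    rw [neg_pow]
    ring
  · have : ContinuousAt (orderCDF r) x := by
      unfold orderCDF
      have := Real.continuousAt_log hpos.ne'
      fun_prop
    exact this.continuousWithinAt

theorem integral_ramp_poisson (r : ℕ) (τ : NNReal) :
    ∫ x, ramp r 1 x ∂((poissonMeasure τ).map (Nat.cast : ℕ → ℝ))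
      = Real.exp (-τ) * ∑ i ∈ Finset.range (r + 1), (τ : ℝ) ^ i / (i.factorial : ℝ) := by
  rw [integral_map (measurable_of_countable _).aemeasurable
    (continuous_ramp _ _).aestronglyMeasurable, integral_poissonMeasure,
    tsum_eq_sum (s := Finset.range (r + 1)), Finset.mul_sum]
  · refine Finset.sum_congr rfl fun i hi => ?_
    rw [ramp_natCast, if_pos (Nat.lt_succ_iff.1 (Finset.mem_range.1 hi)), smul_eq_mul]
    ring
  · intro i hi
    rw [ramp_natCast, if_neg (by simpa using hi), smul_zero]

end OrderCDF

/-! ### Limits for one and for several levels -/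

section Thresholds

variable {Ω : Type*} [MeasurableSpace Ω] {μ : Measure Ω} [IsProbabilityMeasure μ]
  {X : ℕ → Ω → ℝ}

theorem tendsto_fewExceed_zero {ι : Type*} [Fintype ι] (hmeas : ∀ i, Measurable (X i))
    (hindep : iIndepFun X μ) (hident : ∀ i, IdentDistrib (X i) (X 0) μ μ) {v : ℕ → ι → ℝ}
    (r : ι → ℕ) (j : ι)
    (hv : Tendsto (fun n => (1 - μ.real {ω | v n j < X 0 ω}) ^ n) atTop (𝓝 0)) :
    Tendsto (fun n => μ.real (fewExceed X (v n) r (Finset.range n))) atTop (𝓝 0) := by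
  have hinf := tendsto_mul_atTop_of_tendsto_one_sub_pow (fun n => measureReal_nonneg) hv
  have hlim := hinf.const_div_atTop ((2 : ℝ) ^ (r j + 1))
  refine squeeze_zero' (Eventually.of_forall fun n => measureReal_nonneg) ?_ hlim
  filter_upwards [hinf.eventually_gt_atTop 0] with n hn
  have h := measureReal_exceedCount_le_mul hmeas hindep hident (Finset.range n) (v n j) (r j)
  rw [Finset.card_range] at h
  rw [le_div_iff₀ hn]
  refine le_trans ?_ h
  gcongr
  exacts [measure_ne_top μ _, fun ω hω => hω j]

/-- For `g > 0` the mean count tends to `-log g` and the count limit has the Poisson characteristic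
function; for `g = 0` the mean count diverges and the event becomes negligible. -/
theorem asympIndepSum_single (hmeas : ∀ i, Measurable (X i)) (hindep : iIndepFun X μ)
    (hident : ∀ i, IdentDistrib (X i) (X 0) μ μ) (hmean : ∫ ω, X 0 ω ∂μ = 0)
    (hvar : ∫ ω, X 0 ω ^ 2 ∂μ = 1) (hL2 : MemLp (X 0) 2 μ) {v : ℕ → ℝ} {g : ℝ} (hg0 : 0 ≤ g)
    (hg1 : g ≤ 1) (hv : Tendsto (fun n => (1 - μ.real {ω | v n < X 0 ω}) ^ n) atTop (𝓝 g)) (r : ℕ) :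
    AsympIndepSum μ X (fun n (_ : Unit) => v n) (fun _ => r) (orderCDF r g) := by
  rcases eq_or_lt_of_le hg0 with rfl | hpos
  · rw [orderCDF_zero]
    exact asympIndepSum_zero hmeas (tendsto_fewExceed_zero hmeas hindep hident (fun _ => r) () hv)
  · have hτ := tendsto_mul_of_tendsto_one_sub_pow
      (fun n => measureReal_le_one) hpos hv
    obtain ⟨κ, hκ, hA⟩ := exists_asympIndepSum_of_tendsto (ι := Unit) (v := fun n _ => v n)
      (τ := fun _ => -Real.log g) hmeas hindep hident hmean hvar hL2 fun J hJ => by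
        obtain ⟨j, hj⟩ := hJ
        refine hτ.congr fun n => ?_
        congr 3
        ext ω
        exact ⟨fun h _ _ => h, fun h => h j hj⟩
    have hlog : 0 ≤ -Real.log g := neg_nonneg.2 (Real.log_nonpos hg0 hg1)
    have heval : Measurable fun z : EuclideanSpace ℝ Unit => z () := by fun_prop
    have hmap : (κ : Measure (EuclideanSpace ℝ Unit)).map (fun z => z ())
        = (poissonMeasure (-Real.log g).toNNReal).map (Nat.cast : ℕ → ℝ) := by
      have := Measure.isProbabilityMeasure_map (μ := (κ : Measure (EuclideanSpace ℝ Unit)))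
        heval.aemeasurable
      have := Measure.isProbabilityMeasure_map (μ := poissonMeasure (-Real.log g).toNNReal)
        (measurable_of_countable (Nat.cast : ℕ → ℝ)).aemeasurable
      refine Measure.ext_of_charFun (funext fun u => ?_)
      rw [charFun_map_cast_poissonMeasure, charFun_apply_real, integral_map heval.aemeasurable
        (by fun_prop)]
      have h := hκ (WithLp.toLp 2 fun _ => u)
      have hexp : countExponent (fun _ : Finset Unit => -Real.log g) (fun _ => u)
          = ((-Real.log g).toNNReal : ℝ) * (Complex.exp (u * Complex.I) - 1) := by
        have herase : (Finset.univ : Finset (Finset Unit)).erase ∅ = {{()}} := by decide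
        unfold countExponent
        rw [Real.coe_toNNReal _ hlog]
        convert! Finset.sum_singleton _ ({()} : Finset Unit) using 1
        simp
        ring_nf
      rw [charFun_apply] at h
      simp only [PiLp.inner_apply] at h
      simp only [Finset.univ_unique, Finset.sum_singleton, Real.inner_apply] at h
      rw [hexp] at h
      rw [← h]
      refine integral_congr_ae (Eventually.of_forall fun z => ?_)
      simp only [PUnit.default_eq_unit, Complex.ofReal_mul]
      rw [mul_comm (u : ℂ)]
    have hval : ∫ z, orthantRamp (fun _ : Unit => r) z ∂(κ : Measure (EuclideanSpace ℝ Unit))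
        = orderCDF r g := by
      have h1 : ∀ z : EuclideanSpace ℝ Unit, orthantRamp (fun _ : Unit => r) z = ramp r 1 (z ()) :=
        fun z => by
          change ∏ j : Unit, ramp r 1 (z j) = _
          simp
      simp_rw [h1]
      rw [← integral_map (f := ramp r 1) heval.aemeasurable
        (continuous_ramp _ _).aestronglyMeasurable, hmap,
        integral_ramp_poisson, Real.coe_toNNReal _ hlog, neg_neg, Real.exp_log hpos, orderCDF]
    rw [← hval]
    exact hA fun _ => r

/-- As `a n > 0`, the levels are ordered like the `x j`, uniformly in `n`. Exceeding all levels in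
`J` means exceeding the largest one, so the joint rates converge. -/
theorem exists_asympIndepSum {ι : Type*} [Fintype ι] (hmeas : ∀ i, Measurable (X i))
    (hindep : iIndepFun X μ) (hident : ∀ i, IdentDistrib (X i) (X 0) μ μ)
    (hmean : ∫ ω, X 0 ω ∂μ = 0) (hvar : ∫ ω, X 0 ω ^ 2 ∂μ = 1) (hL2 : MemLp (X 0) 2 μ)
    {a b : ℕ → ℝ} (ha : ∀ n, 1 ≤ n → 0 < a n) {G : ℝ → ℝ} (hG0 : ∀ t, 0 ≤ G t)
    (hG : ∀ t, Tendsto (fun n => (1 - μ.real {ω | t / a n + b n < X 0 ω}) ^ n) atTop (𝓝 (G t)))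
    (x : ι → ℝ) (r : ι → ℕ) :
    ∃ h, AsympIndepSum μ X (fun n j => x j / a n + b n) r h := by
  by_cases hzero : ∃ j, G (x j) = 0
  · obtain ⟨j, hj⟩ := hzero
    exact ⟨0, asympIndepSum_zero hmeas
      (tendsto_fewExceed_zero hmeas hindep hident r j (by simpa [hj] using hG (x j)))⟩
  · push Not at hzero
    have hmax : ∀ J : Finset ι, ∃ τ : ℝ, J.Nonempty → Tendsto (fun n : ℕ =>
        n * μ.real {ω | ∀ j ∈ J, x j / a n + b n < X 0 ω}) atTop (𝓝 τ) := by
      intro J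
      rcases J.eq_empty_or_nonempty with rfl | hJ
      · exact ⟨0, fun h => absurd h (by simp)⟩
      obtain ⟨j, hj, hjmax⟩ := J.exists_max_image x hJ
      refine ⟨-Real.log (G (x j)), fun _ => ?_⟩
      refine (tendsto_mul_of_tendsto_one_sub_pow
        (fun n => measureReal_le_one) (lt_of_le_of_ne (hG0 _) (hzero j).symm) (hG (x j))).congr' ?_
      filter_upwards [eventually_ge_atTop 1] with n hn
      congr 2
      ext ω
      refine ⟨fun h i hi => lt_of_le_of_lt ?_ h, fun h => h j hj⟩
      have := ha n hn
      gcongr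
      exact hjmax i hi
    choose τ hτ using hmax
    obtain ⟨κ, -, hA⟩ := exists_asympIndepSum_of_tendsto hmeas hindep hident hmean hvar hL2
      (v := fun n j => x j / a n + b n) (τ := τ) hτ
    exact ⟨_, hA r⟩

end Thresholds

/-! ### The joint limit is a distribution function -/

section LimitLaw

variable {ι : Type*} [Fintype ι]

/-- A vector of large norm has a large coordinate, so a union bound reduces tightness to the tails
of the marginal limits. -/
theorem isTightMeasureSet_of_tendsto_marginals {P : ℕ → ProbabilityMeasure (ι → ℝ)}
    {M : ι → ℝ → ℝ}
    (hM : ∀ j t, Tendsto (fun n => (P n : Measure (ι → ℝ)).real {z | z j ≤ t}) atTop (𝓝 (M j t)))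
    (hbot : ∀ j, Tendsto (M j) atBot (𝓝 0)) (htop : ∀ j, Tendsto (M j) atTop (𝓝 1)) :
    IsTightMeasureSet (Set.range fun n => (P n : Measure (ι → ℝ))) := by
  refine isTightMeasureSet_range_of_tendsto_limsup_measure_norm_gt ?_
  set R : ℝ → ℝ := fun t => ∑ j, (M j (-t) + (1 - M j t)) with hR
  have hR0 : Tendsto R atTop (𝓝 0) := by
    have : Tendsto R atTop (𝓝 (∑ _j : ι, ((0 : ℝ) + (1 - 1)))) :=
      tendsto_finsetSum _ fun j _ => ((hbot j).comp tendsto_neg_atTop_atBot).add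
        ((htop j).const_sub 1)
    simpa using this
  have hR0' := ENNReal.tendsto_ofReal hR0
  rw [ENNReal.ofReal_zero] at hR0'
  refine tendsto_of_tendsto_of_tendsto_of_le_of_le' tendsto_const_nhds hR0'
    (Eventually.of_forall fun _ => zero_le) ?_
  filter_upwards [eventually_ge_atTop 0] with t ht
  have hbound : ∀ n, (P n : Measure (ι → ℝ)) {z | t < ‖z‖} ≤ ENNReal.ofReal
      (∑ j, ((P n : Measure (ι → ℝ)).real {z | z j ≤ -t} +
        (1 - (P n : Measure (ι → ℝ)).real {z | z j ≤ t}))) := by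
    intro n
    have hsub : {z : ι → ℝ | t < ‖z‖} ⊆ ⋃ j, ({z | z j ≤ -t} ∪ {z | z j ≤ t}ᶜ) := by
      intro z hz
      simp only [Set.mem_ofPred_eq] at hz
      by_contra hcon
      simp only [Set.mem_iUnion, Set.mem_union, Set.mem_ofPred_eq, Set.mem_compl_iff,
        not_exists, not_or, not_le] at hcon
      exact absurd hz (not_lt.2 ((pi_norm_le_iff_of_nonneg ht).2 fun j =>
        abs_le.2 ⟨(hcon j).1.le, not_lt.1 (hcon j).2⟩))
    rw [← ofReal_measureReal (measure_ne_top _ _)]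
    refine ENNReal.ofReal_le_ofReal ?_
    calc (P n : Measure (ι → ℝ)).real {z | t < ‖z‖}
        ≤ (P n : Measure (ι → ℝ)).real (⋃ j, ({z | z j ≤ -t} ∪ {z | z j ≤ t}ᶜ)) :=
          measureReal_mono hsub (measure_ne_top _ _)
      _ ≤ ∑ j, (P n : Measure (ι → ℝ)).real ({z | z j ≤ -t} ∪ {z | z j ≤ t}ᶜ) :=
          measureReal_iUnion_fintype_le _
      _ ≤ _ := Finset.sum_le_sum fun j _ => by
          refine (measureReal_union_le _ _).trans ?_
          rw [probReal_compl_eq_one_sub (measurableSet_le (measurable_pi_apply j) measurable_const)]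
  refine (limsup_le_limsup (Eventually.of_forall hbound)).trans_eq (Tendsto.limsup_eq ?_)
  exact ENNReal.tendsto_ofReal (tendsto_finsetSum _ fun j _ =>
    (hM j (-t)).add ((hM j t).const_sub 1))

/-- Laws on `ℝ^ι` whose joint distribution functions converge everywhere converge to a law, as soon
as the limits of the marginal distribution functions are themselves distribution functions. -/
theorem exists_law_of_tendsto_Iic {P : ℕ → ProbabilityMeasure (ι → ℝ)} {L : (ι → ℝ) → ℝ}
    {M : ι → ℝ → ℝ}
    (hL : ∀ x, Tendsto (fun n => (P n : Measure (ι → ℝ)).real (Set.Iic x)) atTop (𝓝 (L x)))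
    (hM : ∀ j t, Tendsto (fun n => (P n : Measure (ι → ℝ)).real {z | z j ≤ t}) atTop (𝓝 (M j t)))
    (hbot : ∀ j, Tendsto (M j) atBot (𝓝 0)) (htop : ∀ j, Tendsto (M j) atTop (𝓝 1))
    (hright : ∀ j t, Tendsto (fun δ => M j (t + δ)) (𝓝[>] 0) (𝓝 (M j t))) :
    ∃ H : ProbabilityMeasure (ι → ℝ), ∀ x, (H : Measure (ι → ℝ)).real (Set.Iic x) = L x := by
  have htight := isTightMeasureSet_of_tendsto_marginals hM hbot htop
  have hcompact : IsCompact (closure (Set.range P)) := by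
    refine isCompact_closure_of_isTightMeasureSet ?_
    convert htight using 1
    ext m
    simp
  let U : Ultrafilter ℕ := Ultrafilter.of atTop
  have hU : (U : Filter ℕ) ≤ atTop := Ultrafilter.of_le atTop
  obtain ⟨H, -, hH⟩ := hcompact.ultrafilter_le_nhds (U.map P)
    (le_principal_iff.2 (Ultrafilter.mem_map.2 (univ_mem' fun n =>
      subset_closure (Set.mem_range_self n))))
  have hHt : Tendsto P U (𝓝 H) := hH
  have hLenn : ∀ x, Tendsto (fun n => (P n : Measure (ι → ℝ)) (Set.Iic x)) U
      (𝓝 (ENNReal.ofReal (L x))) := fun x => by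
    refine (ENNReal.tendsto_ofReal ((hL x).mono_left hU)).congr fun n => ?_
    exact ofReal_measureReal (measure_ne_top _ _)
  have hL0 : ∀ x, 0 ≤ L x := fun x => ge_of_tendsto' (hL x) fun n => measureReal_nonneg
  refine ⟨H, fun x => le_antisymm ?_ ?_⟩
  -- Portmanteau for an open box slightly larger than the orthant gives `L (x + δ)`. Its excess over
  -- `L x` is at most the sum of the marginal increments, which vanish as `δ → 0` by right
  -- continuity.
  · have hstep : ∀ δ : ℝ, 0 < δ → (H : Measure (ι → ℝ)).real (Set.Iic x)
        ≤ L x + ∑ j, (M j (x j + δ) - M j (x j)) := by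
      intro δ hδ
      set O : Set (ι → ℝ) := Set.univ.pi fun j => Set.Iio (x j + δ) with hO
      have hOo : IsOpen O := isOpen_set_pi Set.finite_univ fun j _ => isOpen_Iio
      have hsub : Set.Iic x ⊆ O := fun z hz j _ => lt_of_le_of_lt (hz j) (lt_add_of_pos_right _ hδ)
      have h1 := ProbabilityMeasure.le_liminf_measure_open_of_tendsto hHt hOo
      have h2 : (H : Measure (ι → ℝ)) O ≤ ENNReal.ofReal (L fun j => x j + δ) := by
        refine h1.trans ?_
        rw [← (hLenn fun j => x j + δ).liminf_eq]
        exact liminf_le_liminf (Eventually.of_forall fun n =>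
          measure_mono fun z hz j => (hz j (Set.mem_univ j)).le)
      have h3 : (H : Measure (ι → ℝ)).real (Set.Iic x) ≤ L fun j => x j + δ :=
        ENNReal.toReal_le_of_le_ofReal (hL0 _) ((measure_mono hsub).trans h2)
      have h4 : (L fun j => x j + δ) ≤ L x + ∑ j, (M j (x j + δ) - M j (x j)) := by
        refine le_of_tendsto_of_tendsto' (hL _) ((hL x).add (tendsto_finsetSum _ fun j _ =>
          (hM j (x j + δ)).sub (hM j (x j)))) fun n => ?_
        have hcover : Set.Iic (fun j => x j + δ) ⊆ Set.Iic x ∪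
            ⋃ j, ({z : ι → ℝ | z j ≤ x j + δ} \ {z | z j ≤ x j}) := by
          intro z hz
          by_cases hzx : z ≤ x
          · exact Or.inl hzx
          · simp only [Pi.le_def, not_forall] at hzx
            obtain ⟨j, hj⟩ := hzx
            exact Or.inr (Set.mem_iUnion.2 ⟨j, hz j, hj⟩)
        refine (measureReal_mono hcover (measure_ne_top _ _)).trans
          ((measureReal_union_le _ _).trans ?_)
        gcongr
        refine (measureReal_iUnion_fintype_le _).trans (Finset.sum_le_sum fun j _ => ?_)
        have hle : {z : ι → ℝ | z j ≤ x j} ⊆ {z | z j ≤ x j + δ} :=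
          fun z (hz : z j ≤ x j) => hz.trans (by linarith)
        rw [measureReal_sdiff hle (measurableSet_le (measurable_pi_apply j) measurable_const)]
      exact h3.trans h4
    have hlim : Tendsto (fun δ => L x + ∑ j, (M j (x j + δ) - M j (x j))) (𝓝[>] 0) (𝓝 (L x)) := by
      have := (tendsto_finsetSum Finset.univ fun j _ =>
        (hright j (x j)).sub_const (M j (x j))).const_add (L x)
      simpa using this
    exact ge_of_tendsto hlim (eventually_nhdsWithin_of_forall fun δ hδ => hstep δ hδ)
  -- The reverse inequality is portmanteau for the closed orthant.
  · have h1 := ProbabilityMeasure.limsup_measure_closed_le_of_tendsto hHt (isClosed_Iic (a := x))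
    rw [(hLenn x).limsup_eq] at h1
    exact (ENNReal.ofReal_le_iff_le_toReal (measure_ne_top _ _)).1 h1

end LimitLaw

/-! ### Transfer to normalised order statistics -/

section OrderStatisticLimits

variable {Ω : Type*} [MeasurableSpace Ω] {X : ℕ → Ω → ℝ}

theorem measurable_kthMax (hmeas : ∀ i, Measurable (X i)) (k n : ℕ) : Measurable (kthMax X k n) := by
  by_cases hk : 1 ≤ k ∧ k ≤ n
  · refine measurable_of_Iic fun v => ?_
    have : kthMax X k n ⁻¹' Set.Iic v = exceedCount X (Finset.range n) v ⁻¹' Set.Iic (k - 1) := by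
      ext ω
      exact kthMax_le_iff hk.1 hk.2 v ω
    rw [this]
    exact measurable_exceedCount hmeas _ _ measurableSet_Iic
  · have : kthMax X k n = fun _ => 0 := by
      funext ω
      rw [kthMax]
      split_ifs with h1
      · rw [List.getD_eq_default]
        simp
        omega
      · rfl
    rw [this]
    exact measurable_const

end OrderStatisticLimits

theorem mul_kthMax_sub_le_iff {Ω : Type*} {X : ℕ → Ω → ℝ} {a b : ℕ → ℝ} (ha : ∀ n, 1 ≤ n → 0 < a n) {k n : ℕ} (hk : 1 ≤ k)
    (hkn : k ≤ n) (x : ℝ) (ω : Ω) : a n * (kthMax X k n ω - b n) ≤ x ↔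
      exceedCount X (Finset.range n) (x / a n + b n) ω ≤ k - 1 := by
  have han := ha n (hk.trans hkn)
  rw [← kthMax_le_iff hk hkn, ← sub_le_iff_le_add, le_div_iff₀ han, mul_comm]

theorem tendsto_one_sub_measureReal_lt_pow {Ω : Type*} [MeasurableSpace Ω] {μ : Measure Ω}
    [IsProbabilityMeasure μ] {X : ℕ → Ω → ℝ} (hmeas : ∀ i, Measurable (X i))
    (hindep : iIndepFun X μ) (hident : ∀ i, IdentDistrib (X i) (X 0) μ μ) {a b : ℕ → ℝ}
    (ha : ∀ n, 1 ≤ n → 0 < a n) {t g : ℝ}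
    (hlim : Tendsto (fun n : ℕ => μ.real {ω | a n * (kthMax X 1 n ω - b n) ≤ t}) atTop (𝓝 g)) :
    Tendsto (fun n => (1 - μ.real {ω | t / a n + b n < X 0 ω}) ^ n) atTop (𝓝 g) := by
  refine hlim.congr' ?_
  filter_upwards [eventually_ge_atTop 1] with n hn
  have h := measureReal_exceedCount_le_zero hmeas hindep hident (Finset.range n) (t / a n + b n)
  rw [Finset.card_range] at h
  rw [← h]
  congr 1
  ext ω
  exact mul_kthMax_sub_le_iff ha le_rfl hn t ω

theorem forall_mul_kthMax_sub_le_iff {Ω : Type*} {X : ℕ → Ω → ℝ} {a b : ℕ → ℝ}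
    (ha : ∀ n, 1 ≤ n → 0 < a n) {k n : ℕ} (hkn : k ≤ n) (x : Fin k → ℝ) (ω : Ω) :
    (∀ j : Fin k, a n * (kthMax X (j + 1) n ω - b n) ≤ x j) ↔
      ω ∈ fewExceed X (fun j => x j / a n + b n) (fun j : Fin k => (j : ℕ)) (Finset.range n) :=
  forall_congr' fun j =>
    mul_kthMax_sub_le_iff ha (Nat.le_add_left 1 j) (Nat.succ_le_of_lt (j.2.trans_le hkn)) (x j) ω

/-- The marginal limits are `orderCDF j` composed with a distribution function. Continuity of
`orderCDF j` on `[0, ∞)` and its values at `0` and `1` supply the tail limits and right continuity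
that prevent loss of mass. -/
theorem exists_law_orderStatistics {Ω : Type*} [MeasurableSpace Ω] {μ : Measure Ω}
    [IsProbabilityMeasure μ] {X : ℕ → Ω → ℝ} (hmeas : ∀ i, Measurable (X i)) {a b : ℕ → ℝ}
    (ha : ∀ n, 1 ≤ n → 0 < a n) (ν : Measure ℝ) [IsProbabilityMeasure ν] {k : ℕ}
    {L : (Fin k → ℝ) → ℝ}
    (hL : ∀ x : Fin k → ℝ, Tendsto (fun n => μ.real (fewExceed X (fun j => x j / a n + b n)
      (fun j : Fin k => (j : ℕ)) (Finset.range n))) atTop (𝓝 (L x)))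
    (hM : ∀ (j : ℕ) (t : ℝ), Tendsto (fun n => μ.real (fewExceed X (fun _ : Unit => t / a n + b n)
      (fun _ => j) (Finset.range n))) atTop (𝓝 (orderCDF j (cdf ν t)))) :
    ∃ H : ProbabilityMeasure (Fin k → ℝ), ∀ x, (H : Measure (Fin k → ℝ)).real (Set.Iic x) = L x := by
  set Y : ℕ → Ω → Fin k → ℝ := fun n ω j => a n * (kthMax X (j + 1) n ω - b n) with hY
  have hYm : ∀ n, Measurable (Y n) := fun n => measurable_pi_lambda _ fun j =>
    ((measurable_kthMax hmeas (j + 1) n).sub_const _).const_mul _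
  let P : ℕ → ProbabilityMeasure (Fin k → ℝ) := fun n =>
    ⟨μ.map (Y n), Measure.isProbabilityMeasure_map (hYm n).aemeasurable⟩
  have hP : ∀ n {s : Set (Fin k → ℝ)}, MeasurableSet s →
      (P n : Measure (Fin k → ℝ)).real s = μ.real (Y n ⁻¹' s) := fun n s hs =>
    map_measureReal_apply (hYm n) hs
  have hcont : ∀ (j : ℕ) (g : ℝ), 0 ≤ g → ContinuousWithinAt (orderCDF j) (Set.Ici 0) g :=
    fun j g hg => continuousOn_orderCDF j g hg
  have hcomp : ∀ (j : ℕ) {l : Filter ℝ} {u : ℝ → ℝ} {g : ℝ}, 0 ≤ g →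
      Tendsto (fun s => cdf ν (u s)) l (𝓝 g) →
      Tendsto (fun s => orderCDF j (cdf ν (u s))) l (𝓝 (orderCDF j g)) := fun j l u g hg h =>
    (hcont j g hg).tendsto.comp (tendsto_nhdsWithin_iff.2
      ⟨h, Eventually.of_forall fun s => cdf_nonneg ν (u s)⟩)
  refine exists_law_of_tendsto_Iic (P := P) (M := fun j t => orderCDF j (cdf ν t)) (fun x => ?_)
    (fun j t => ?_) (fun j => ?_) (fun j => ?_) (fun j t => ?_)
  · refine (hL x).congr' ?_
    filter_upwards [eventually_ge_atTop k] with n hn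
    rw [hP n measurableSet_Iic]
    congr 1
    ext ω
    exact (forall_mul_kthMax_sub_le_iff ha hn x ω).symm
  · refine (hM j t).congr' ?_
    filter_upwards [eventually_ge_atTop k] with n hn
    rw [hP n (measurableSet_le (measurable_pi_apply j) measurable_const)]
    congr 1
    ext ω
    exact ⟨fun h => (mul_kthMax_sub_le_iff ha (Nat.le_add_left 1 j)
      (Nat.succ_le_of_lt (j.2.trans_le hn)) t ω).2 (h ()), fun h _ =>
      (mul_kthMax_sub_le_iff ha (Nat.le_add_left 1 j)
        (Nat.succ_le_of_lt (j.2.trans_le hn)) t ω).1 h⟩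
  · rw [← orderCDF_zero (j : ℕ)]
    exact hcomp j (u := id) le_rfl (tendsto_cdf_atBot ν)
  · rw [← orderCDF_one (j : ℕ)]
    exact hcomp j (u := id) zero_le_one (tendsto_cdf_atTop ν)
  · refine hcomp j (u := fun δ => t + δ) (cdf_nonneg ν t) ?_
    have h := (cdf ν).right_continuous t
    refine h.tendsto.comp (tendsto_nhdsWithin_iff.2 ⟨?_, ?_⟩)
    · have : Tendsto (fun δ : ℝ => t + δ) (𝓝 0) (𝓝 (t + 0)) := by
        exact (continuous_const.add continuous_id).tendsto 0
      rw [add_zero] at this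
      exact this.mono_left nhdsWithin_le_nhds
    · exact eventually_nhdsWithin_of_forall fun δ hδ =>
        Set.mem_Ici.2 (le_add_of_nonneg_right (le_of_lt hδ))

theorem theorem3p1 {Ω : Type*} [MeasurableSpace Ω] (μ : Measure Ω) [IsProbabilityMeasure μ]
    (X : ℕ → Ω → ℝ)
    (hmeas : ∀ i, Measurable (X i))
    (hindep : iIndepFun X μ)
    (hident : ∀ i, IdentDistrib (X i) (X 0) μ μ)
    (hmean : ∫ ω, X 0 ω ∂μ = 0)
    (hvar : ∫ ω, (X 0 ω) ^ 2 ∂μ = 1)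
    (a b : ℕ → ℝ) (ha : ∀ n, 1 ≤ n → 0 < a n)
    (ν : Measure ℝ) [IsProbabilityMeasure ν]
    (hν : ∀ c : ℝ, ν ≠ Measure.dirac c)
    (hlim : ∀ x : ℝ, Tendsto (fun n : ℕ => μ.real {ω | a n * (kthMax X 1 n ω - b n) ≤ x})
      atTop (𝓝 (cdf ν x)))
    (k : ℕ) (hk : 1 ≤ k) :
    (∀ x y : ℝ, ∀ᵐ ω ∂μ, Tendsto
      (fun N : ℕ => logAverage (fun n => {ω' | a n * (kthMax X k n ω' - b n) ≤ x ∧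
        partialSum X n ω' / √(n : ℝ) ≤ y}) N ω)
      atTop
      (𝓝 (cdf ν x * (∑ i ∈ Finset.range k, (-Real.log (cdf ν x)) ^ i / (i.factorial : ℝ)) *
        stdNormalCDF y))) ∧
    (∃ H : Measure (Fin k → ℝ), IsProbabilityMeasure H ∧
      (∀ x : Fin k → ℝ, Tendsto
        (fun n : ℕ => μ.real {ω | ∀ j : Fin k, a n * (kthMax X (j + 1) n ω - b n) ≤ x j})
        atTop (𝓝 (H.real (Set.Iic x)))) ∧
      (∀ (x : Fin k → ℝ) (y : ℝ), ∀ᵐ ω ∂μ, Tendsto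
        (fun N : ℕ => logAverage
          (fun n => {ω' | (∀ j : Fin k, a n * (kthMax X (j + 1) n ω' - b n) ≤ x j) ∧
            partialSum X n ω' / √(n : ℝ) ≤ y}) N ω)
        atTop (𝓝 (H.real (Set.Iic x) * stdNormalCDF y)))) := by
  -- The integral of a non-integrable function is `0` by convention, so the second moment being `1`
  -- already yields square integrability.
  have hL2 : MemLp (X 0) 2 μ := (memLp_two_iff_integrable_sq (hmeas 0).aestronglyMeasurable).2
    (.of_integral_ne_zero (by rw [hvar]; exact one_ne_zero))
  have hL2' : ∀ i, MemLp (X i) 2 μ := fun i => (hident i).memLp_iff.2 hL2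
  have hG := fun t => tendsto_one_sub_measureReal_lt_pow hmeas hindep hident ha (hlim t)
  have hsingle := fun (r : ℕ) (t : ℝ) => asympIndepSum_single hmeas hindep hident hmean hvar hL2
    (cdf_nonneg ν t) (cdf_le_one ν t) (hG t) r
  refine ⟨fun x y => ?_, ?_⟩
  · have h := ae_tendsto_logAverage_fewExceed hmeas hindep hident hmean hvar hL2'
      (hsingle (k - 1) x) y
    rw [orderCDF, Nat.sub_add_cancel hk] at h
    filter_upwards [h] with ω hω
    refine logAverage_tendsto_congr ?_ hω
    filter_upwards [eventually_ge_atTop k] with n hn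
    ext ω'
    exact and_congr_left' ((mul_kthMax_sub_le_iff ha hk hn x ω').trans
      ⟨fun h _ => h, fun h => h ()⟩)
  · choose L hL using fun x : Fin k → ℝ => exists_asympIndepSum hmeas hindep hident hmean hvar hL2
      ha (fun t => cdf_nonneg ν t) hG x fun j => (j : ℕ)
    obtain ⟨H, hH⟩ := exists_law_orderStatistics hmeas ha ν (fun x => (hL x).1)
      fun j t => (hsingle j t).1
    refine ⟨H, inferInstance, fun x => ?_, fun x y => ?_⟩
    · rw [hH x]
      refine (hL x).1.congr' ?_
      filter_upwards [eventually_ge_atTop k] with n hn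
      congr 1
      ext ω
      exact (forall_mul_kthMax_sub_le_iff ha hn x ω).symm
    · rw [hH x]
      filter_upwards [ae_tendsto_logAverage_fewExceed hmeas hindep hident hmean hvar hL2' (hL x) y]
        with ω hω
      refine logAverage_tendsto_congr ?_ hω
      filter_upwards [eventually_ge_atTop k] with n hn
      ext ω'
      exact and_congr_left' (forall_mul_kthMax_sub_le_iff ha hn x ω')
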